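/- Let $(\mathcal M,g)$ be a smooth four-dimensional spacetime of signature $(-,+,+,+)$ that is stationary: it carries a smooth one-parameter group of isometries $\varphi_s$ whose generator $t^a$ (a Killing vector field) is timelike; the static case, in which $t^a$ is hypersurface orthogonal, is included. Let $\Sigma=\{\tau=c\}$ be a spacelike slice of constant $\tau$, where $\tau$ is a smooth time coordinate with $\tau(\varphi_s(x))=\tau(x)+s$. Let $S_0\subset\Sigma$ be a closed (compact without boundary) smooth embedded two-surface that divides $\Sigma$ into an inside region and an outside region, each of which has all of $S_0$ in its closure. Let $S$ be the three-dimensional static/stationary timelike hypersurface obtained by transporting $S_0$ along the integral lines of $t^a$; the inside and outside regions of $S$ are obtained by transporting those of $S_0$. Let $\hat r^a$ be the outward unit normal to $S$, let $P_{ab}=g_{ab}-\hat r_a\hat r_b$ and let $\bar K_{ab}=\tfrac12\pounds_{\hat r}P_{ab}$ be the extrinsic curvature of $S$. $S$ is called a transversely trapping surface (TTS) if every light ray (future-directed null geodesic, with the time orientation in which $t^a$ is future directed) emitted from any point of $S$ in any direction tangent to $S$ propagates on $S$ or toward the inside region of $S$, that is, it stays in the union of $S$ and the inside region for some positive parameter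 time after emission. Then $S$ is a TTS if and only if, at every point of $S$, $\bar K_{ab}k^ak^b\le 0$ for every null vector $k^a$ tangent to $S$. -/

import Mathlib

open Set Filter Topology
open scoped Manifold ContDiff

noncomputable section

/-- The model space of a four-dimensional spacetime. -/
abbrev E4 : Type := EuclideanSpace ℝ (Fin 4)

/-! ### Lorentzian metrics -/

/-- A smooth Lorentzian metric of signature `(-,+,+,+)` on a smooth four-manifold. -/
structure LorentzianMetric (M : Type*) [TopologicalSpace M] [ChartedSpace E4 M]
    [IsManifold (𝓡 4) ∞ M] where
  /-- The bilinear form on each tangent space. -/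
  val (x : M) : TangentSpace (𝓡 4) x →L[ℝ] TangentSpace (𝓡 4) x →L[ℝ] ℝ
  symm (x : M) (v w : TangentSpace (𝓡 4) x) : val x v w = val x w v
  /-- There is a timelike vector whose orthogonal complement is positive definite. -/
  lorentzian (x : M) : ∃ T : TangentSpace (𝓡 4) x, val x T T < 0 ∧
    ∀ v : TangentSpace (𝓡 4) x, val x T v = 0 → v ≠ 0 → 0 < val x v v
  contMDiff : ContMDiff (𝓡 4) ((𝓡 4).prod 𝓘(ℝ, E4 →L[ℝ] E4 →L[ℝ] ℝ)) ∞
    (fun x : M ↦ Bundle.TotalSpace.mk' (E4 →L[ℝ] E4 →L[ℝ] ℝ)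
      (E := fun y : M ↦ TangentSpace (𝓡 4) y →L[ℝ] TangentSpace (𝓡 4) y →L[ℝ] ℝ) x (val x))

namespace Spacetime

variable {M : Type*} [TopologicalSpace M] [ChartedSpace E4 M] [IsManifold (𝓡 4) ∞ M]

/-- The differential of a real function, as a covector on the tangent space. -/
def differential (f : M → ℝ) (x : M) : TangentSpace (𝓡 4) x →L[ℝ] ℝ :=
  mfderiv (𝓡 4) 𝓘(ℝ, ℝ) f x

/-- The velocity of the curve `γ` at parameter `t`. -/
def velocity (γ : ℝ → M) (t : ℝ) : TangentSpace (𝓡 4) (γ t) :=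
  mfderiv 𝓘(ℝ, ℝ) (𝓡 4) γ t (1 : ℝ)

/-! ### Stationary spacetimes -/

/-- The generator `t^a` of a flow `φ`: the velocity at parameter `0` of the orbit through `x`. -/
def generator (φ : ℝ → M → M) (x : M) : TangentSpace (𝓡 4) x :=
  mfderiv 𝓘(ℝ, ℝ) (𝓡 4) (fun s : ℝ ↦ φ s x) 0 (1 : ℝ)

/-- `φ` is a smooth one-parameter group of isometries of `(M, g)` with timelike orbits. Its
generator is thus a timelike Killing vector field, and `(M, g)` is a stationary spacetime.
Static spacetimes are the special case in which the generator is hypersurface orthogonal. -/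
structure IsStationaryFlow (g : LorentzianMetric M) (φ : ℝ → M → M) : Prop where
  smooth : ContMDiff (𝓘(ℝ, ℝ).prod (𝓡 4)) (𝓡 4) ∞ (fun q : ℝ × M ↦ φ q.1 q.2)
  zero : ∀ x, φ 0 x = x
  add : ∀ s s' x, φ (s + s') x = φ s (φ s' x)
  isometry : ∀ (s : ℝ) (x : M) (u v : TangentSpace (𝓡 4) x),
    g.val (φ s x) (mfderiv (𝓡 4) (𝓡 4) (φ s) x u) (mfderiv (𝓡 4) (𝓡 4) (φ s) x v) = g.val x u v
  timelike : ∀ x, g.val x (generator φ x) (generator φ x) < 0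

/-- `τ` is a smooth time coordinate adapted to the flow: it is the flow parameter along each
orbit. -/
structure IsAdaptedTime (φ : ℝ → M → M) (τ : M → ℝ) : Prop where
  smooth : ContMDiff (𝓡 4) 𝓘(ℝ, ℝ) ∞ τ
  flow : ∀ s x, τ (φ s x) = τ x + s

/-- The slice `τ = c`. -/
def slice (τ : M → ℝ) (c : ℝ) : Set M := {x | τ x = c}

/-- The slice `τ = c` is spacelike. -/
def IsSpacelikeSlice (g : LorentzianMetric M) (τ : M → ℝ) (c : ℝ) : Prop :=
  ∀ x ∈ slice τ c, ∀ v : TangentSpace (𝓡 4) x,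
    differential τ x v = 0 → v ≠ 0 → 0 < g.val x v v

/-- `S₀` is a smooth embedded two-surface in the slice `τ = c`: locally it is the zero set, within
the slice, of a smooth function whose differential does not vanish on the tangent space of the
slice. -/
def IsEmbeddedSurfaceInSlice (τ : M → ℝ) (c : ℝ) (S₀ : Set M) : Prop :=
  S₀ ⊆ slice τ c ∧ ∀ p ∈ S₀, ∃ (U : Set M) (f : M → ℝ), IsOpen U ∧ p ∈ U ∧
    ContMDiffOn (𝓡 4) 𝓘(ℝ, ℝ) ∞ f U ∧
    S₀ ∩ U = {x ∈ U | x ∈ slice τ c ∧ f x = 0} ∧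
    ∃ v : TangentSpace (𝓡 4) p,
      differential τ p v = 0 ∧ differential f p v ≠ 0

/-- The hypersurface `Sig` is divided by `S₀` into the inside region `In` and the outside region
`Out`: these are disjoint, relatively open in `Sig`, exhaust `Sig` away from `S₀`, and `S₀` bounds
both of them. -/
structure Divides (Sig S₀ In Out : Set M) : Prop where
  union : In ∪ S₀ ∪ Out = Sig
  disjoint_in : Disjoint In S₀
  disjoint_out : Disjoint Out S₀
  disjoint_in_out : Disjoint In Out
  open_in : ∃ U, IsOpen U ∧ In = U ∩ Sig
  open_out : ∃ U, IsOpen U ∧ Out = U ∩ Sig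
  boundary_in : S₀ ⊆ closure In
  boundary_out : S₀ ⊆ closure Out

/-- The set swept out by transporting `A` along the orbits of the flow. -/
def transport (φ : ℝ → M → M) (A : Set M) : Set M := {x | ∃ s : ℝ, ∃ y ∈ A, x = φ s y}

/-! ### Tangent vectors and outward unit normals of a hypersurface -/

/-- `c` is a curve with `c 0 = p` and velocity `v` there. -/
def HasInitialVelocity (c : ℝ → M) (p : M) (v : TangentSpace (𝓡 4) p) : Prop :=
  ∃ h : c 0 = p, HasMFDerivAt 𝓘(ℝ, ℝ) (𝓡 4) c 0
    (ContinuousLinearMap.toSpanSingleton ℝ (h ▸ v : TangentSpace (𝓡 4) (c 0)))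

/-- `v` is tangent to `S` at `p ∈ S`: it is the velocity of a curve in `S` through `p`. -/
def IsTangentTo (S : Set M) (p : M) (v : TangentSpace (𝓡 4) p) : Prop :=
  ∃ c : ℝ → M, HasInitialVelocity c p v ∧ ∀ᶠ t in 𝓝 (0 : ℝ), c t ∈ S

/-- `v` points from `p` into the region `D`: a curve starting at `p` with velocity `v` immediately
enters `D`. -/
def PointsInto (D : Set M) (p : M) (v : TangentSpace (𝓡 4) p) : Prop :=
  ∃ c : ℝ → M, HasInitialVelocity c p v ∧ ∀ᶠ t in 𝓝[>] (0 : ℝ), c t ∈ D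

/-- `r` is the outward unit normal of `S` at `p`, where `D` is the outside region. -/
def IsOutwardUnitNormalAt (g : LorentzianMetric M) (S D : Set M) (p : M)
    (r : TangentSpace (𝓡 4) p) : Prop :=
  g.val p r r = 1 ∧ (∀ v, IsTangentTo S p v → g.val p r v = 0) ∧ PointsInto D p r

/-- `r` is a smooth vector field near `p` which on `S` is the outward unit normal. -/
def IsOutwardUnitNormalNear (g : LorentzianMetric M) (S D : Set M) (p : M)
    (r : (x : M) → TangentSpace (𝓡 4) x) : Prop :=
  ∃ U : Set M, IsOpen U ∧ p ∈ U ∧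
    ContMDiffOn (𝓡 4) ((𝓡 4).prod (𝓡 4)) ∞
      (fun x : M ↦ Bundle.TotalSpace.mk' E4 (E := fun y : M ↦ TangentSpace (𝓡 4) y) x (r x)) U ∧
    ∀ x ∈ S ∩ U, IsOutwardUnitNormalAt g S D x (r x)

/-- `k` is a null vector. -/
def IsNull (g : LorentzianMetric M) (p : M) (k : TangentSpace (𝓡 4) p) : Prop :=
  k ≠ 0 ∧ g.val p k k = 0

/-! ### Charts, Christoffel symbols, geodesics, extrinsic curvature -/

/-- `e` is a smooth chart around `p`. -/
def IsChartAt (e : OpenPartialHomeomorph M E4) (p : M) : Prop :=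
  e ∈ IsManifold.maximalAtlas (𝓡 4) ∞ M ∧ p ∈ e.source

/-- The coordinate components, in the chart `e`, of tangent vectors at `x`. -/
def toCoord (e : OpenPartialHomeomorph M E4) (x : M) : TangentSpace (𝓡 4) x →L[ℝ] E4 :=
  mfderiv (𝓡 4) (𝓡 4) e x

/-- The tangent vector at the point with coordinates `y` in the chart `e` that has given coordinate
components. -/
def ofCoord (e : OpenPartialHomeomorph M E4) (y : E4) :
    E4 →L[ℝ] TangentSpace (𝓡 4) (e.symm y) :=
  mfderiv (𝓡 4) (𝓡 4) e.symm y

/-- The metric read in the chart `e`: at the coordinate point `y`, on coordinate vectors. -/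
def chartMetric (g : LorentzianMetric M) (e : OpenPartialHomeomorph M E4) (y v w : E4) : ℝ :=
  g.val (e.symm y) (ofCoord e y v) (ofCoord e y w)

/-- The Christoffel symbols of the first kind in the chart `e`,
`Γ(u, v, w) = (∂_u g(v, w) + ∂_v g(u, w) - ∂_w g(u, v)) / 2`. -/
def christoffel (g : LorentzianMetric M) (e : OpenPartialHomeomorph M E4) (y u v w : E4) : ℝ :=
  (fderiv ℝ (fun z ↦ chartMetric g e z v w) y u + fderiv ℝ (fun z ↦ chartMetric g e z u w) y v
    - fderiv ℝ (fun z ↦ chartMetric g e z u v) y w) / 2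

/-- The coordinate curve `x` satisfies at parameter `t` the (affinely parametrized) geodesic
equation of the chart `e`, with the free index lowered:
`g(x'', w) + Γ(x', x', w) = 0` for all `w`. -/
def GeodesicEqAt (g : LorentzianMetric M) (e : OpenPartialHomeomorph M E4) (x : ℝ → E4) (t : ℝ) :
    Prop :=
  DifferentiableAt ℝ x t ∧ DifferentiableAt ℝ (deriv x) t ∧
    ∀ w : E4, chartMetric g e (x t) (deriv (deriv x) t) w
      + christoffel g e (x t) (deriv x t) (deriv x t) w = 0

/-- `γ` is a geodesic on the open parameter interval `(a, b)`: near each parameter it solves the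
geodesic equation in a chart (the equation is chart independent). -/
def IsGeodesicOn (g : LorentzianMetric M) (γ : ℝ → M) (a b : ℝ) : Prop :=
  ∀ t₀ ∈ Ioo a b, ∃ e : OpenPartialHomeomorph M E4, IsChartAt e (γ t₀) ∧
    ∀ᶠ t in 𝓝 t₀, γ t ∈ e.source ∧ GeodesicEqAt g e (fun s ↦ e (γ s)) t

/-- `γ` is a light ray on `(a, b)`: a geodesic whose velocity is null and future directed, the time
orientation being the one in which the generator of `φ` is future directed. -/
def IsLightRayOn (g : LorentzianMetric M) (φ : ℝ → M → M) (γ : ℝ → M) (a b : ℝ) : Prop :=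
  IsGeodesicOn g γ a b ∧ ∀ t ∈ Ioo a b, IsNull g (γ t) (velocity γ t) ∧
    g.val (γ t) (generator φ (γ t)) (velocity γ t) < 0

/-- `S` is a transversely trapping surface with inside region `D`: every light ray emitted from a
point of `S` in a direction tangent to `S` propagates on `S` or toward the inside, that is, it
stays in `S ∪ D` for some positive time after emission. -/
def IsTTS (g : LorentzianMetric M) (φ : ℝ → M → M) (S D : Set M) : Prop :=
  ∀ (γ : ℝ → M) (a b : ℝ), a < 0 → 0 < b → IsLightRayOn g φ γ a b →
    γ 0 ∈ S → IsTangentTo S (γ 0) (velocity γ 0) →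
    ∀ᶠ t in 𝓝[>] (0 : ℝ), γ t ∈ S ∪ D

/-- The vector field `r` read in the chart `e`. -/
def chartField (e : OpenPartialHomeomorph M E4) (r : (x : M) → TangentSpace (𝓡 4) x) (y : E4) :
    E4 :=
  toCoord e (e.symm y) (r (e.symm y))

/-- The tensor `P_ab = g_ab - r_a r_b` read in the chart `e`. -/
def chartProj (g : LorentzianMetric M) (e : OpenPartialHomeomorph M E4)
    (r : (x : M) → TangentSpace (𝓡 4) x) (y v w : E4) : ℝ :=
  chartMetric g e y v w
    - chartMetric g e y (chartField e r y) v * chartMetric g e y (chartField e r y) w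

/-- The Lie derivative of a covariant 2-tensor field `T` along a vector field `R` on a coordinate
domain: `(£_R T)_ab = R^c ∂_c T_ab + T_cb ∂_a R^c + T_ac ∂_b R^c`. -/
def lieDerivTensor (R : E4 → E4) (T : E4 → E4 → E4 → ℝ) (y v w : E4) : ℝ :=
  fderiv ℝ (fun z ↦ T z v w) y (R y) + T y (fderiv ℝ R y v) w + T y v (fderiv ℝ R y w)

/-- The extrinsic curvature `(1/2) £_r P_ab` at `p`, computed in the chart `e`, for a hypersurface
with unit normal `r`. On vectors tangent to the hypersurface it depends neither on the chart nor
on the extension of the unit normal off the hypersurface. -/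
def extrinsicCurvature (g : LorentzianMetric M) (e : OpenPartialHomeomorph M E4)
    (r : (x : M) → TangentSpace (𝓡 4) x) (p : M) (u v : TangentSpace (𝓡 4) p) : ℝ :=
  lieDerivTensor (chartField e r) (chartProj g e r) (e p)
    (toCoord e p u) (toCoord e p v) / 2

end Spacetime

end

/-! Near a point of the transported surface S, choose a coordinate function `f` that is constant
along the flow, has nonvanishing differential, vanishes exactly on S, is negative inside and
positive outside. Along a geodesic γ the function h = f ∘ γ satisfies h' = df(γ') and h'' = Hess
f(γ', γ'), with the covariant Hessian. On S the outward unit normal R is the normalized gradient of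
`f`, and for k tangent to S the extrinsic curvature is K(k, k) = Hess f(k, k) / df(R) with df(R) > 0
(`lieDerivTensor_unitNormal`). The claim thus compares the sign of Hess f on null tangent vectors
with the sign of h shortly after emission.

If K(k, k) > 0 for some null tangent k, the geodesic with initial velocity k, or -k if k is past
directed, has h(0) = h'(0) = 0 and h''(0) > 0. It enters the outside at once, so S is not a TTS.

The converse is delicate because K ≤ 0 is not strict and says nothing off S, where the ray may
travel. The null vectors tangent to S form the zero set of the map (y, v) ↦ (f(y), df(v), g(v, v)).
This map is a submersion there: the timelike generator is tangent to S, and a nonzero null vector is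
never orthogonal to it. A null vector near S therefore lies within C (|f| + |df(v)|) of a null
tangent vector, where Hess f ≤ 0. Since Hess f is locally Lipschitz, h'' ≤ C' (|h| + |h'|) along the
ray (`exists_covHess_le`). With h(0) = h'(0) = 0 this differential inequality forces h ≤ 0 for a
short time (`eventually_nonpos_of_second_deriv_le`), so the ray stays in S or inside. -/

noncomputable section

/-! ### Real and functional analysis: metric regularity, second-order differential inequalities,
regular level sets. -/

section Analysis

/-- Metric regularity: near a zero of a map with surjective strict derivative, the distance to the
zero set is controlled by the value of the map. -/
theorem HasStrictFDerivAt.exists_zero_norm_sub_le {E F : Type*} [NormedAddCommGroup E]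
    [NormedSpace ℝ E] [CompleteSpace E] [NormedAddCommGroup F] [NormedSpace ℝ F] [CompleteSpace F]
    {H : E → F} {H' : E →L[ℝ] F} {z₀ : E} (h : HasStrictFDerivAt H H' z₀)
    (hs : H'.range = ⊤) (h0 : H z₀ = 0) :
    ∃ C : ℝ, 0 ≤ C ∧ ∀ᶠ z in 𝓝 z₀, ∃ z', H z' = 0 ∧ ‖z' - z‖ ≤ C * ‖H z‖ := by
  let f'symm := H'.nonlinearRightInverseOfSurjective hs
  have hpos : 0 < f'symm.nnnorm := H'.nonlinearRightInverseOfSurjective_nnnorm_pos hs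
  -- Approximating `H` by `H'` up to `c` costs `c` out of `f'symm.nnnorm⁻¹`. Taking half leaves
  -- exactly `c`, so the ball of radius `c⁻¹ * ‖H z‖` about `z` covers the ball of radius `‖H z‖`
  -- about `H z`, which contains 0.
  set c : NNReal := f'symm.nnnorm⁻¹ / 2 with hc
  have cpos : 0 < c := by positivity
  obtain ⟨s, hs0, happ⟩ := h.approximates_deriv_on_nhds (c := c) (Or.inr cpos)
  obtain ⟨δ, δ0, hδ⟩ := Metric.mem_nhds_iff.1 hs0
  have cpos' : (0 : ℝ) < c := by exact_mod_cast cpos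
  refine ⟨(c : ℝ)⁻¹, by positivity, ?_⟩
  have hcont : Tendsto (fun z ↦ (c : ℝ)⁻¹ * ‖H z‖) (𝓝 z₀) (𝓝 0) := by
    have := (h.continuousAt.norm).const_mul ((c : ℝ)⁻¹)
    simpa [ContinuousAt, h0] using this
  filter_upwards [Metric.ball_mem_nhds z₀ (half_pos δ0),
    hcont.eventually (gt_mem_nhds (half_pos δ0))] with z hz hz'
  have hsub : Metric.closedBall z ((c : ℝ)⁻¹ * ‖H z‖) ⊆ s := by
    refine Subset.trans (fun w hw ↦ ?_) hδ
    rw [Metric.mem_ball] at hz ⊢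
    rw [Metric.mem_closedBall] at hw
    linarith [dist_triangle w z z₀]
  have hsurj := happ.surjOn_closedBall_of_nonlinearRightInverse f'symm
    (ε := (c : ℝ)⁻¹ * ‖H z‖) (b := z) (by positivity) hsub
  have hk : (f'symm.nnnorm : ℝ)⁻¹ - c = c := by
    rw [hc]; push_cast; ring
  have hmem : (0 : F) ∈ Metric.closedBall (H z)
      (((f'symm.nnnorm : ℝ)⁻¹ - c) * ((c : ℝ)⁻¹ * ‖H z‖)) := by
    rw [hk, mul_inv_cancel_left₀ cpos'.ne']
    simp
  obtain ⟨z', hz1, hz2⟩ := hsurj hmem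
  exact ⟨z', hz2, by simpa [dist_eq_norm] using hz1⟩

/-- If `h'' ≤ C (|h| + |h'|)` near `0` and `h` vanishes to first order at `0`, then `h ≤ 0` shortly
after `0`. -/
theorem eventually_nonpos_of_second_deriv_le {h u w : ℝ → ℝ} {C : ℝ}
    (hh : ∀ᶠ t in 𝓝 0, HasDerivAt h (u t) t) (hu : ∀ᶠ t in 𝓝 0, HasDerivAt u (w t) t)
    (h0 : h 0 = 0) (u0 : u 0 = 0) (hw : ∀ᶠ t in 𝓝 0, w t ≤ C * (|h t| + |u t|)) :
    ∀ᶠ t in 𝓝[>] (0 : ℝ), h t ≤ 0 := by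
  obtain ⟨δ, δ0, hδ⟩ := Metric.eventually_nhds_iff.1 (hh.and (hu.and hw))
  set K : ℝ := max C 0 with hK
  -- Two smallness conditions fix `T`: `T ≤ 1` bounds `|h|` by the maximum of `|u|`, and `K * 2 * T
  -- < 1` makes every rise of `u` smaller than that maximum.
  have hK0 : 0 ≤ K := le_max_right _ _
  obtain ⟨T, T0, Tδ, T1, TK⟩ : ∃ T : ℝ, 0 < T ∧ T < δ ∧ T ≤ 1 ∧ K * 2 * T < 1 := by
    refine ⟨min (δ / 2) (min 1 (1 / (2 * K + 1) / 2)), by positivity, ?_, ?_, ?_⟩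
    · exact (min_le_left _ _).trans_lt (by linarith)
    · exact (min_le_right _ _).trans (min_le_left _ _)
    · have : min (δ / 2) (min 1 (1 / (2 * K + 1) / 2)) ≤ 1 / (2 * K + 1) / 2 :=
        (min_le_right _ _).trans (min_le_right _ _)
      calc _ ≤ K * 2 * (1 / (2 * K + 1) / 2) := by gcongr
        _ < 1 := by
          rw [div_div, mul_one_div, div_lt_one (by positivity)]
          linarith
  have hD : ∀ t ∈ Icc 0 T, HasDerivAt h (u t) t ∧ HasDerivAt u (w t) t ∧
      w t ≤ C * (|h t| + |u t|) := by
    intro t ht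
    apply hδ
    rw [Real.dist_eq, sub_zero, abs_of_nonneg ht.1]
    exact ht.2.trans_lt Tδ
  suffices H : ∀ t ∈ Icc 0 T, h t ≤ 0 by
    filter_upwards [Ioo_mem_nhdsGT T0] with t ht
    exact H t (Ioo_subset_Icc_self ht)
  have hcont : ContinuousOn h (Icc 0 T) := fun t ht ↦
    (hD t ht).1.continuousAt.continuousWithinAt
  obtain ⟨t₁, ht₁, hmax⟩ := isCompact_Icc.exists_isMaxOn (nonempty_Icc.2 T0.le) hcont
  by_contra! hcon
  obtain ⟨t₂, ht₂, hpos⟩ := hcon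
  have hpos₁ : 0 < h t₁ := hpos.trans_le (hmax ht₂)
  have ht₁0 : 0 < t₁ := lt_of_le_of_ne ht₁.1 (by rintro rfl; linarith)
  have hsub : Icc 0 t₁ ⊆ Icc 0 T := Icc_subset_Icc_right ht₁.2
  -- The maximum may sit at the right endpoint `T`, so only slopes from the left are compared.
  have hu1 : 0 ≤ u t₁ := by
    by_contra! hneg
    have := (hD t₁ ht₁).1.tendsto_slope
    have hev : ∀ᶠ s in 𝓝[≠] t₁, slope h t₁ s < 0 := this.eventually (gt_mem_nhds hneg)
    have hev' : ∀ᶠ s in 𝓝[<] t₁, slope h t₁ s < 0 :=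
      hev.filter_mono (nhdsWithin_mono _ fun s hs ↦ ne_of_lt hs)
    obtain ⟨s, hs, hs'⟩ := (hev'.and (Ioo_mem_nhdsLT ht₁0)).exists
    have h1 : h s ≤ h t₁ := hmax ⟨hs'.1.le, hs'.2.le.trans ht₁.2⟩
    rw [slope_def_field] at hs
    have : 0 ≤ (h s - h t₁) / (s - t₁) :=
      div_nonneg_of_nonpos (by linarith) (by linarith [hs'.2])
    linarith
  have hucont : ContinuousOn (fun t ↦ |u t|) (Icc 0 t₁) := fun t ht ↦
    (hD t (hsub ht)).2.1.continuousAt.abs.continuousWithinAt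
  obtain ⟨s, hs, hsmax⟩ := isCompact_Icc.exists_isMaxOn (nonempty_Icc.2 ht₁0.le) hucont
  set m := |u s| with hm
  have hule : ∀ t ∈ Icc 0 t₁, |u t| ≤ m := fun t ht ↦ hsmax ht
  have hhle : ∀ t ∈ Icc 0 t₁, |h t| ≤ m := by
    intro t ht
    have := (convex_Icc 0 t₁).norm_image_sub_le_of_norm_hasDerivWithin_le (f := h) (f' := u)
      (C := m) (fun x hx ↦ (hD x (hsub hx)).1.hasDerivWithinAt) hule
      (left_mem_Icc.2 ht₁0.le) ht
    rw [h0, sub_zero, sub_zero, Real.norm_eq_abs, Real.norm_eq_abs, abs_of_nonneg ht.1] at this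
    have ht1 : t ≤ 1 := ht.2.trans (ht₁.2.trans T1)
    nlinarith [abs_nonneg (u s)]
  have hm0 : 0 ≤ m := abs_nonneg _
  have hmpos : 0 < m := by
    have := hhle t₁ (right_mem_Icc.2 ht₁0.le)
    rw [abs_of_pos hpos₁] at this
    linarith
  have hwle : ∀ t ∈ Icc 0 t₁, w t ≤ K * 2 * m := by
    intro t ht
    calc w t ≤ C * (|h t| + |u t|) := (hD t (hsub ht)).2.2
      _ ≤ K * (|h t| + |u t|) := by gcongr; exact le_max_left _ _
      _ ≤ K * (m + m) := by gcongr; exacts [hhle t ht, hule t ht]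
      _ = K * 2 * m := by ring
  have hincr : ∀ a ∈ Icc 0 t₁, ∀ b ∈ Icc 0 t₁, a ≤ b → u b - u a < m := by
    intro a ha b hb hab
    have hle : u b - u a ≤ K * 2 * m * (b - a) := by
      refine (convex_Icc 0 t₁).image_sub_le_mul_sub_of_deriv_le (f := u) ?_ ?_ ?_ a ha b hb hab
      · exact fun t ht ↦ (hD t (hsub ht)).2.1.continuousAt.continuousWithinAt
      · exact fun t ht ↦
          (hD t (hsub (interior_subset ht))).2.1.differentiableAt.differentiableWithinAt
      · intro t ht
        rw [(hD t (hsub (interior_subset ht))).2.1.deriv]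
        exact hwle t (interior_subset ht)
    have hba : b - a ≤ T := by linarith [ha.1, hb.2, ht₁.2]
    have : K * 2 * m * (b - a) ≤ K * 2 * m * T := by gcongr
    nlinarith
  -- As `w` is bounded only from above, only rises of `u` are controlled. If `u s = m`, then `u`
  -- rises by `m` from `u 0 = 0`. If `u s = -m`, it rises by at least `m` up to `u t₁ ≥ 0`. Both
  -- contradict `hincr`.
  rcases abs_choice (u s) with hc | hc
  · have := hincr 0 (left_mem_Icc.2 ht₁0.le) s hs hs.1
    rw [u0] at this
    linarith
  · have := hincr s hs t₁ (right_mem_Icc.2 ht₁0.le) hs.2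
    linarith

/-- A function that vanishes to first order at `0` and has positive second derivative there is
positive shortly after `0`. -/
theorem eventually_pos_of_second_deriv_pos {h u : ℝ → ℝ} {w : ℝ}
    (hh : ∀ᶠ t in 𝓝 0, HasDerivAt h (u t) t) (hu : HasDerivAt u w 0)
    (h0 : h 0 = 0) (u0 : u 0 = 0) (hw : 0 < w) :
    ∀ᶠ t in 𝓝[>] (0 : ℝ), 0 < h t := by
  have hev : ∀ᶠ s in 𝓝[>] (0 : ℝ), 0 < u s := by
    have : ∀ᶠ s in 𝓝[≠] (0 : ℝ), 0 < slope u 0 s := hu.tendsto_slope.eventually (lt_mem_nhds hw)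
    filter_upwards [this.filter_mono (nhdsWithin_mono _ fun s hs ↦ ne_of_gt hs),
      self_mem_nhdsWithin] with s hs hs0
    rw [slope_def_field, u0, sub_zero, sub_zero] at hs
    exact (div_pos_iff_of_pos_right hs0).1 hs
  obtain ⟨b, hb, hb'⟩ := (mem_nhdsGT_iff_exists_Ioo_subset).1 hev
  obtain ⟨δ, δ0, hδ⟩ := Metric.eventually_nhds_iff.1 hh
  have hb0 : (0 : ℝ) < b := hb
  filter_upwards [Ioo_mem_nhdsGT (lt_min hb0 δ0)] with t ht
  have htb : t < b := ht.2.trans_le (min_le_left _ _)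
  have htδ : t < δ := ht.2.trans_le (min_le_right _ _)
  have hD : ∀ x ∈ Icc 0 t, HasDerivAt h (u x) x := fun x hx ↦ hδ (by
    rw [Real.dist_eq, sub_zero, abs_of_nonneg hx.1]; exact hx.2.trans_lt htδ)
  have := strictMonoOn_of_deriv_pos (convex_Icc 0 t) (f := h)
    (fun x hx ↦ (hD x hx).continuousAt.continuousWithinAt) (by
      intro x hx
      rw [interior_Icc] at hx
      rw [(hD x (Ioo_subset_Icc_self hx)).deriv]
      exact hb' ⟨hx.1, hx.2.trans htb⟩)
  simpa [h0] using this (left_mem_Icc.2 ht.1.le) (right_mem_Icc.2 ht.1.le) ht.1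

/-- A vector in the kernel of the differential of `f` is the velocity of a curve in the zero set
of `f`. -/
theorem HasStrictFDerivAt.exists_curve_in_zero_set {E : Type*} [NormedAddCommGroup E]
    [NormedSpace ℝ E] [CompleteSpace E] {f : E → ℝ} {f' : E →L[ℝ] ℝ} {x v : E}
    (h : HasStrictFDerivAt f f' x) (hf' : f' ≠ 0) (h0 : f x = 0) (hv : f' v = 0) :
    ∃ c : ℝ → E, c 0 = x ∧ HasDerivAt c v 0 ∧ ∀ᶠ t in 𝓝 (0 : ℝ), f (c t) = 0 := by
  have hs : f'.range = ⊤ := by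
    refine LinearMap.range_eq_top.2 (LinearMap.surjective ?_)
    exact fun h ↦ hf' (ContinuousLinearMap.coe_injective h)
  obtain ⟨C, C0, hC⟩ := h.exists_zero_norm_sub_le hs h0
  have hline : HasDerivAt (fun t : ℝ ↦ x + t • v) v 0 := by
    simpa using ((hasDerivAt_id (0 : ℝ)).smul_const v).const_add x
  have htend : Tendsto (fun t : ℝ ↦ x + t • v) (𝓝 0) (𝓝 x) := by
    simpa [ContinuousAt] using hline.continuousAt
  -- The implication makes the choice total; the default 0 occurs only where the regularity estimate
  -- fails, hence not for small `t`.
  have hex : ∀ t : ℝ, ∃ z, (∃ z', f z' = 0 ∧ ‖z' - (x + t • v)‖ ≤ C * ‖f (x + t • v)‖) →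
      f z = 0 ∧ ‖z - (x + t • v)‖ ≤ C * ‖f (x + t • v)‖ := by
    intro t
    by_cases hz : ∃ z', f z' = 0 ∧ ‖z' - (x + t • v)‖ ≤ C * ‖f (x + t • v)‖
    · obtain ⟨z, hz'⟩ := hz
      exact ⟨z, fun _ ↦ hz'⟩
    · exact ⟨0, fun h ↦ absurd h hz⟩
  choose c hc using hex
  have hc0 : c 0 = x := by
    have := (hc 0 ⟨x, h0, by simp [h0]⟩).2
    simpa [h0, sub_eq_zero] using this
  have hev := htend.eventually hC
  refine ⟨c, hc0, ?_, hev.mono fun t ht ↦ (hc t ht).1⟩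
  -- Since `f' v = 0`, the value of `f` on the line is o(t). The correction moving the line into the
  -- zero set is then o(t) too and does not change the velocity.
  have hfl : HasDerivAt (fun t : ℝ ↦ f (x + t • v)) 0 0 := by
    have h1 : HasFDerivAt f f' (x + (0 : ℝ) • v) := by simpa using h.hasFDerivAt
    simpa [hv, Function.comp_def] using h1.comp_hasDerivAt (0 : ℝ) hline
  have hdiff : HasDerivAt (fun t ↦ c t - (x + t • v)) 0 0 := by
    rw [hasDerivAt_iff_isLittleO] at hfl ⊢
    refine Asymptotics.IsBigO.trans_isLittleO (Asymptotics.IsBigO.of_bound C ?_) hfl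
    filter_upwards [hev] with t ht
    simpa [hc0, h0] using (hc t ht).2
  simpa using hdiff.fun_add hline

/-- Near a regular point of `f`, each of the two sides of the zero set of `f` is connected in
arbitrarily small neighbourhoods. -/
theorem HasStrictFDerivAt.exists_nhds_isPreconnected_sides {E : Type*} [NormedAddCommGroup E]
    [NormedSpace ℝ E] [CompleteSpace E] {f : E → ℝ} {f' : E →L[ℝ] ℝ} {x : E}
    (h : HasStrictFDerivAt f f' x) (hf' : f' ≠ 0) {O : Set E} (hO : O ∈ 𝓝 x) :
    ∃ N ⊆ O, IsOpen N ∧ x ∈ N ∧ IsPreconnected {y ∈ N | 0 < f y} ∧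
      IsPreconnected {y ∈ N | f y < 0} := by
  have hs : f'.range = ⊤ := by
    refine LinearMap.range_eq_top.2 (LinearMap.surjective ?_)
    exact fun h ↦ hf' (ContinuousLinearMap.coe_injective h)
  -- In the implicit function chart `f` is the first coordinate, so the two sides become half-balls,
  -- which are convex.
  set Ψ := h.implicitToOpenPartialHomeomorph f f' hs with hΨ
  have hx : x ∈ Ψ.source := h.mem_implicitToOpenPartialHomeomorph_source hs
  have hfst : ∀ y, (Ψ y).1 = f y := fun y ↦ rfl
  have hO' : Ψ.symm ⁻¹' O ∩ Ψ.target ∈ 𝓝 (Ψ x) := by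
    refine inter_mem ?_ (Ψ.open_target.mem_nhds (Ψ.map_source hx))
    apply (Ψ.continuousAt_symm (Ψ.map_source hx)).preimage_mem_nhds
    rwa [Ψ.left_inv hx]
  obtain ⟨ε, ε0, hε⟩ := Metric.mem_nhds_iff.1 hO'
  have hball : Metric.ball (Ψ x) ε ⊆ Ψ.target := fun z hz ↦ (hε hz).2
  have himage : ∀ s ⊆ Metric.ball (Ψ x) ε, Convex ℝ s → IsPreconnected (Ψ.symm '' s) := by
    intro s hs hconv
    exact hconv.isPreconnected.image _ (Ψ.continuousOn_symm.mono (hs.trans hball))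
  refine ⟨Ψ.symm '' Metric.ball (Ψ x) ε, ?_, ?_, ?_, ?_, ?_⟩
  · rintro _ ⟨z, hz, rfl⟩
    exact (hε hz).1
  · exact Ψ.symm.isOpen_image_of_subset_source Metric.isOpen_ball hball
  · exact ⟨Ψ x, Metric.mem_ball_self ε0, Ψ.left_inv hx⟩
  · convert himage (Metric.ball (Ψ x) ε ∩ {z | 0 < z.1}) inter_subset_left
      ((convex_ball _ _).inter (convex_halfSpace_gt (IsLinearMap.mk (fun _ _ ↦ rfl)
        fun _ _ ↦ rfl) 0)) using 1
    ext y
    constructor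
    · rintro ⟨⟨z, hz, rfl⟩, hy⟩
      rw [← hfst, Ψ.right_inv (hball hz)] at hy
      exact ⟨z, ⟨hz, hy⟩, rfl⟩
    · rintro ⟨z, ⟨hz, hy⟩, rfl⟩
      refine ⟨⟨z, hz, rfl⟩, ?_⟩
      rwa [← hfst, Ψ.right_inv (hball hz)]
  · convert himage (Metric.ball (Ψ x) ε ∩ {z | z.1 < 0}) inter_subset_left
      ((convex_ball _ _).inter (convex_halfSpace_lt (IsLinearMap.mk (fun _ _ ↦ rfl)
        fun _ _ ↦ rfl) 0)) using 1
    ext y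
    constructor
    · rintro ⟨⟨z, hz, rfl⟩, hy⟩
      rw [← hfst, Ψ.right_inv (hball hz)] at hy
      exact ⟨z, ⟨hz, hy⟩, rfl⟩
    · rintro ⟨z, ⟨hz, hy⟩, rfl⟩
      refine ⟨⟨z, hz, rfl⟩, ?_⟩
      rwa [← hfst, Ψ.right_inv (hball hz)]

end Analysis

/-! ### Lorentzian geometry on an open set of a vector space: gradients, Hessians, geodesics,
extrinsic curvature. -/

section Coordinates

set_option maxSynthPendingDepth 3

variable {E : Type*} [NormedAddCommGroup E] [NormedSpace ℝ E]

/-- A bilinear form is Lorentzian if it is symmetric and positive definite on the orthogonal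
complement of some timelike vector. -/
def IsLorentzForm (B : E →L[ℝ] E →L[ℝ] ℝ) : Prop :=
  (∀ v w, B v w = B w v) ∧ ∃ T, B T T < 0 ∧ ∀ v, B T v = 0 → v ≠ 0 → 0 < B v v

namespace IsLorentzForm

variable {B : E →L[ℝ] E →L[ℝ] ℝ}

/-- The orthogonal complement of every timelike vector is positive definite. -/
theorem pos_of_orthogonal (hB : IsLorentzForm B) {t v : E} (ht : B t t < 0) (htv : B t v = 0)
    (hv : v ≠ 0) : 0 < B v v := by
  obtain ⟨hs, T, hT, hpos⟩ := hB
  by_contra! hneg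
  have ht0 : t ≠ 0 := by rintro rfl; simp at ht
  have hTt : B T t ≠ 0 := fun h ↦ (hpos t h ht0).not_gt ht
  -- The combination of `t` and `v` orthogonal to `T`. As `t` and `v` are mutually orthogonal and `B
  -- v v ≤ 0`, it has `B u u ≤ 0`, although `T` has a positive definite complement.
  set u := B T v • t - B T t • v with hu
  have hTu : B T u = 0 := by simp [hu]; ring
  have huu : B u u = B T v ^ 2 * B t t + B T t ^ 2 * B v v := by
    simp [hu, htv, hs v t]; ring
  have hu0 : u ≠ 0 := by
    intro h
    have h1 : B t u = 0 := by rw [h, map_zero]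
    have h2 : B T v = 0 := by simpa [hu, htv, ht.ne] using h1
    rw [hu, h2, zero_smul, zero_sub, neg_eq_zero, smul_eq_zero] at h
    exact h.elim hTt hv
  have := hpos u hTu hu0
  nlinarith [sq_nonneg (B T v), sq_nonneg (B T t)]

/-- A nonzero null vector is not orthogonal to a timelike vector. -/
theorem ne_zero_of_null (hB : IsLorentzForm B) {t v : E} (ht : B t t < 0) (hv : v ≠ 0)
    (hvv : B v v = 0) : B t v ≠ 0 :=
  fun h ↦ (hB.pos_of_orthogonal ht h hv).ne' hvv

/-- A vector in the kernel is orthogonal to `T` and null, hence zero by positivity on the complement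
of `T`. -/
theorem injective (hB : IsLorentzForm B) : Function.Injective B := by
  rw [injective_iff_map_eq_zero]
  intro v hv
  obtain ⟨T, hT, hpos⟩ := hB.2
  by_contra hv0
  have h1 : B T v = 0 := by rw [hB.1 T v, hv]; rfl
  have := hpos v h1 hv0
  rw [hv] at this
  exact lt_irrefl _ this

theorem isInvertible [FiniteDimensional ℝ E] (hB : IsLorentzForm B) : B.IsInvertible := by
  have hfin : Module.finrank ℝ E = Module.finrank ℝ (E →L[ℝ] ℝ) := by
    rw [← (LinearMap.toContinuousLinearMap (𝕜 := ℝ) (E := E) (F' := ℝ)).finrank_eq]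
    exact (Subspace.dual_finrank_eq (K := ℝ) (V := E)).symm
  refine ⟨(LinearEquiv.ofInjectiveOfFinrankEq B.toLinearMap hB.injective
    hfin).toContinuousLinearEquiv, ?_⟩
  ext v w
  rfl

end IsLorentzForm

/-- A triangular system: the value of `a` is set first, then that of `b` is corrected along `t`,
which `a` does not see. -/
theorem exists_covector_values {a b : E →L[ℝ] ℝ} {t : E} (ha : a ≠ 0) (hat : a t = 0)
    (hbt : b t ≠ 0) (r s : ℝ) : ∃ v, a v = r ∧ b v = s := by
  obtain ⟨n, hn⟩ : ∃ n, a n ≠ 0 := by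
    by_contra! h
    exact ha (ContinuousLinearMap.ext h)
  refine ⟨(r / a n) • n + ((s - r / a n * b n) / b t) • t, ?_, ?_⟩
  · simp [hat, hn]
  · simp [hbt]

/-- The Christoffel symbols of the first kind of a field of bilinear forms. -/
def firstKind (G : E → E →L[ℝ] E →L[ℝ] ℝ) (y u v : E) : E →L[ℝ] ℝ :=
  (2 : ℝ)⁻¹ • (fderiv ℝ G y u v + fderiv ℝ G y v u - ((fderiv ℝ G y).flip u).flip v)

theorem firstKind_apply (G : E → E →L[ℝ] E →L[ℝ] ℝ) (y u v w : E) :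
    firstKind G y u v w =
      (fderiv ℝ G y u v w + fderiv ℝ G y v u w - fderiv ℝ G y w u v) / 2 := by
  simp [firstKind]; ring

/-- The gradient of `f` with respect to the metric `G`. -/
def metricGrad (G : E → E →L[ℝ] E →L[ℝ] ℝ) (f : E → ℝ) (y : E) : E :=
  (G y).inverse (fderiv ℝ f y)

/-- The covariant Hessian of `f` evaluated on `(v, v)`. -/
def covHess (G : E → E →L[ℝ] E →L[ℝ] ℝ) (f : E → ℝ) (y v : E) : ℝ :=
  fderiv ℝ (fderiv ℝ f) y v v - firstKind G y v v (metricGrad G f y)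

/-- A smooth field of Lorentzian forms on an open set. -/
structure IsLorentzField (G : E → E →L[ℝ] E →L[ℝ] ℝ) (O : Set E) : Prop where
  isOpen : IsOpen O
  contDiffOn : ContDiffOn ℝ ∞ G O
  isLorentzForm : ∀ y ∈ O, IsLorentzForm (G y)

variable {G : E → E →L[ℝ] E →L[ℝ] ℝ} {O : Set E} {f : E → ℝ}

namespace IsLorentzField

theorem contDiffAt (hG : IsLorentzField G O) {y : E} (hy : y ∈ O) : ContDiffAt ℝ ∞ G y :=
  hG.contDiffOn.contDiffAt (hG.isOpen.mem_nhds hy)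

theorem differentiableAt (hG : IsLorentzField G O) {y : E} (hy : y ∈ O) :
    DifferentiableAt ℝ G y :=
  (hG.contDiffAt hy).differentiableAt (by simp)

theorem fderiv_symm (hG : IsLorentzField G O) {y : E} (hy : y ∈ O) (u v w : E) :
    fderiv ℝ G y u v w = fderiv ℝ G y u w v := by
  have key : ∀ v w, fderiv ℝ (fun z ↦ G z v w) y u = fderiv ℝ G y u v w := fun v w ↦ by
    have := ((hG.differentiableAt hy).hasFDerivAt.clm_apply (hasFDerivAt_const v y)).clm_apply
      (hasFDerivAt_const w y)
    rw [this.fderiv]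
    simp
  rw [← key, ← key]
  have : (fun z ↦ G z v w) =ᶠ[𝓝 y] fun z ↦ G z w v := by
    filter_upwards [hG.isOpen.mem_nhds hy] with z hz
    exact (hG.isLorentzForm z hz).1 v w
  rw [this.fderiv_eq]

theorem fderiv_apply₂ (hG : IsLorentzField G O) {y : E} (hy : y ∈ O) (u v w : E) :
    fderiv ℝ (fun z ↦ G z v w) y u = fderiv ℝ G y u v w := by
  have := ((hG.differentiableAt hy).hasFDerivAt.clm_apply (hasFDerivAt_const v y)).clm_apply
    (hasFDerivAt_const w y)
  rw [this.fderiv]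
  simp

theorem contDiffAt_firstKind (hG : IsLorentzField G O) {y : E} (hy : y ∈ O) (v : E) :
    ContDiffAt ℝ ∞ (fun z : E × E ↦ firstKind G z.1 z.2 z.2) (y, v) := by
  have h1 : ContDiffAt ℝ ∞ (fun z : E × E ↦ fderiv ℝ G z.1) (y, v) :=
    ContDiffAt.comp (g := fderiv ℝ G) (y, v) ((hG.contDiffAt hy).fderiv_right (by simp))
      contDiffAt_fst
  have h2 : ContDiffAt ℝ ∞ (fun z : E × E ↦ z.2) (y, v) := contDiffAt_snd
  have h3 := (h1.clm_apply h2).clm_apply h2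
  have h4 : ContDiffAt ℝ ∞ (fun z : E × E ↦ (fderiv ℝ G z.1).flip) (y, v) :=
    (ContinuousLinearMap.flipₗᵢ ℝ E E (E →L[ℝ] ℝ)).contDiff.contDiffAt.comp _ h1
  have h5 : ContDiffAt ℝ ∞ (fun z : E × E ↦ ((fderiv ℝ G z.1).flip z.2).flip) (y, v) :=
    (ContinuousLinearMap.flipₗᵢ ℝ E E ℝ).contDiff.contDiffAt.comp _ (h4.clm_apply h2)
  exact ((h3.add h3).sub (h5.clm_apply h2)).const_smul _

variable [FiniteDimensional ℝ E]

theorem apply_metricGrad (hG : IsLorentzField G O) {y : E} (hy : y ∈ O) (v : E) :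
    G y (metricGrad G f y) v = fderiv ℝ f y v := by
  rw [metricGrad]
  have h : G y ((G y).inverse (fderiv ℝ f y)) = fderiv ℝ f y := by
    obtain ⟨M, hM⟩ := (hG.isLorentzForm y hy).isInvertible
    rw [← hM]
    simp
  rw [h]

theorem contDiffAt_metricGrad (hG : IsLorentzField G O) (hf : ContDiffOn ℝ ∞ f O) {y : E}
    (hy : y ∈ O) : ContDiffAt ℝ ∞ (metricGrad G f) y := by
  have h1 : ContDiffAt ℝ ∞ (fun y ↦ (G y).inverse) y :=
    (hG.isLorentzForm y hy).isInvertible.contDiffAt_map_inverse.comp y (hG.contDiffAt hy)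
  have h2 : ContDiffAt ℝ ∞ (fderiv ℝ f) y :=
    (hf.contDiffAt (hG.isOpen.mem_nhds hy)).fderiv_right (by simp)
  exact h1.clm_apply h2

theorem contDiffAt_covHess (hG : IsLorentzField G O) (hf : ContDiffOn ℝ ∞ f O) {y : E}
    (hy : y ∈ O) (v : E) : ContDiffAt ℝ ∞ (fun z : E × E ↦ covHess G f z.1 z.2) (y, v) := by
  have h0 : ContDiffAt ℝ ∞ (fderiv ℝ f) y :=
    (hf.contDiffAt (hG.isOpen.mem_nhds hy)).fderiv_right (by simp)
  have h1 : ContDiffAt ℝ ∞ (fun z : E × E ↦ fderiv ℝ (fderiv ℝ f) z.1) (y, v) :=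
    ContDiffAt.comp (g := fderiv ℝ (fderiv ℝ f)) (y, v) (h0.fderiv_right (by simp)) contDiffAt_fst
  have h2 : ContDiffAt ℝ ∞ (fun z : E × E ↦ z.2) (y, v) := contDiffAt_snd
  have h3 : ContDiffAt ℝ ∞ (fun z : E × E ↦ metricGrad G f z.1) (y, v) :=
    ContDiffAt.comp (g := metricGrad G f) (y, v) (hG.contDiffAt_metricGrad hf hy) contDiffAt_fst
  exact ((h1.clm_apply h2).clm_apply h2).sub ((hG.contDiffAt_firstKind hy v).clm_apply h3)

end IsLorentzField

variable [FiniteDimensional ℝ E]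

/-- The lowered geodesic equation at parameter `t` for a curve `x`. -/
def CoordGeodesicAt (G : E → E →L[ℝ] E →L[ℝ] ℝ) (x : ℝ → E) (t : ℝ) : Prop :=
  DifferentiableAt ℝ x t ∧ DifferentiableAt ℝ (deriv x) t ∧
    ∀ w : E, G (x t) (deriv (deriv x) t) w + firstKind G (x t) (deriv x t) (deriv x t) w = 0

/-- Along a geodesic the second derivative of `f` is its covariant Hessian. -/
theorem CoordGeodesicAt.hasDerivAt (hG : IsLorentzField G O) (hf : ContDiffOn ℝ ∞ f O) {x : ℝ → E}
    {t : ℝ} (hx : CoordGeodesicAt G x t) (hxO : x t ∈ O) :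
    HasDerivAt (fun s ↦ f (x s)) (fderiv ℝ f (x t) (deriv x t)) t ∧
      HasDerivAt (fun s ↦ fderiv ℝ f (x s) (deriv x s)) (covHess G f (x t) (deriv x t)) t := by
  have hfx := hf.contDiffAt (hG.isOpen.mem_nhds hxO)
  obtain ⟨h1, h2, h3⟩ := hx
  refine ⟨(hfx.differentiableAt (by simp)).hasFDerivAt.comp_hasDerivAt t h1.hasDerivAt, ?_⟩
  have hf2 : DifferentiableAt ℝ (fderiv ℝ f) (x t) :=
    (hfx.fderiv_right (m := ∞) (by simp)).differentiableAt (by simp)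
  have h4 := (hf2.hasFDerivAt.comp_hasDerivAt t h1.hasDerivAt).clm_apply h2.hasDerivAt
  refine h4.congr_deriv ?_
  have h5 := h3 (metricGrad G f (x t))
  rw [(hG.isLorentzForm _ hxO).1, hG.apply_metricGrad hxO] at h5
  rw [covHess]
  simp only [Function.comp_apply]
  linarith

/-- If the covariant Hessian of `f` is nonpositive on null vectors tangent to the zero set of `f`,
then on all nearby null vectors it is controlled by the values of `f` and of its differential. -/
theorem exists_covHess_le (hG : IsLorentzField G O) (hf : ContDiffOn ℝ ∞ f O) {y v t : E}
    (hy : y ∈ O) (hfy : f y = 0) (hdf : fderiv ℝ f y ≠ 0) (hv : fderiv ℝ f y v = 0)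
    (hv0 : v ≠ 0) (hvv : G y v v = 0) (ht : G y t t < 0) (hft : fderiv ℝ f y t = 0)
    (hQ : ∀ᶠ z : E × E in 𝓝 (y, v), f z.1 = 0 → fderiv ℝ f z.1 z.2 = 0 → G z.1 z.2 z.2 = 0 →
      covHess G f z.1 z.2 ≤ 0) :
    ∃ C : ℝ, ∀ᶠ z : E × E in 𝓝 (y, v), G z.1 z.2 z.2 = 0 →
      covHess G f z.1 z.2 ≤ C * (|f z.1| + |fderiv ℝ f z.1 z.2|) := by
  have hGt : G y v t ≠ 0 := by
    rw [(hG.isLorentzForm y hy).1]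
    exact (hG.isLorentzForm y hy).ne_zero_of_null ht hv0 hvv
  -- The zeros of `H` over `O` are the null vectors tangent to the zero set of `f`, together with
  -- zero vectors.
  let H : E × E → ℝ × ℝ × ℝ := fun z ↦ (f z.1, fderiv ℝ f z.1 z.2, G z.1 z.2 z.2)
  have hfy' := hf.contDiffAt (hG.isOpen.mem_nhds hy)
  have hf2 : ContDiffAt ℝ ∞ (fderiv ℝ f) y := hfy'.fderiv_right (by simp)
  have c1 : ContDiffAt ℝ ∞ (fun z : E × E ↦ f z.1) (y, v) :=
    ContDiffAt.comp (g := f) (y, v) hfy' contDiffAt_fst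
  have c2 : ContDiffAt ℝ ∞ (fun z : E × E ↦ fderiv ℝ f z.1) (y, v) :=
    ContDiffAt.comp (g := fderiv ℝ f) (y, v) hf2 contDiffAt_fst
  have c3 : ContDiffAt ℝ ∞ (fun z : E × E ↦ G z.1) (y, v) :=
    ContDiffAt.comp (g := G) (y, v) (hG.contDiffAt hy) contDiffAt_fst
  have cs : ContDiffAt ℝ ∞ (fun z : E × E ↦ z.2) (y, v) := contDiffAt_snd
  have hH : ContDiffAt ℝ ∞ H (y, v) :=
    c1.prodMk ((c2.clm_apply cs).prodMk ((c3.clm_apply cs).clm_apply cs))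
  have hstrict := hH.hasStrictFDerivAt (by simp)
  have hfst : HasFDerivAt (fun z : E × E ↦ z.1) (ContinuousLinearMap.fst ℝ E E) (y, v) :=
    hasFDerivAt_fst
  have hsnd : HasFDerivAt (fun z : E × E ↦ z.2) (ContinuousLinearMap.snd ℝ E E) (y, v) :=
    hasFDerivAt_snd
  have d1 : HasFDerivAt (fun z : E × E ↦ f z.1)
      ((fderiv ℝ f y).comp (ContinuousLinearMap.fst ℝ E E)) (y, v) :=
    (hfy'.differentiableAt (by simp)).hasFDerivAt.comp (y, v) hfst
  have d2 : HasFDerivAt (fun z : E × E ↦ fderiv ℝ f z.1)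
      ((fderiv ℝ (fderiv ℝ f) y).comp (ContinuousLinearMap.fst ℝ E E)) (y, v) :=
    (hf2.differentiableAt (by simp)).hasFDerivAt.comp (y, v) hfst
  have d3 : HasFDerivAt (fun z : E × E ↦ G z.1)
      ((fderiv ℝ G y).comp (ContinuousLinearMap.fst ℝ E E)) (y, v) :=
    (hG.differentiableAt hy).hasFDerivAt.comp (y, v) hfst
  have hH' := d1.prodMk ((d2.clm_apply hsnd).prodMk ((d3.clm_apply hsnd).clm_apply hsnd))
  -- The base displacement `a` realizes the first component. The fibre displacement `b` then adjusts
  -- the other two, where it enters through `df` and `2 G(v, ·)`; these are independent because `t`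
  -- is annihilated by `df` but not by `G(v, ·)`.
  have hsurj : (fderiv ℝ H (y, v)).range = ⊤ := by
    rw [LinearMap.range_eq_top]
    rintro ⟨r₁, r₂, r₃⟩
    obtain ⟨a, ha, -⟩ := exists_covector_values hdf hft hGt r₁ 0
    obtain ⟨b, hb, hb'⟩ := exists_covector_values hdf hft hGt
      (r₂ - fderiv ℝ (fderiv ℝ f) y a v) ((r₃ - fderiv ℝ G y a v v) / 2)
    refine ⟨(a, b), ?_⟩
    change fderiv ℝ H (y, v) (a, b) = _
    rw [hH'.fderiv]
    have hs := (hG.isLorentzForm y hy).1 b v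
    ext
    · simp [ha]
    · simp [hb]
    · simp [hb', hs]; ring
  have hH0 : H (y, v) = 0 := by simp [H, hfy, hv, hvv]
  obtain ⟨C, C0, hC⟩ := hstrict.exists_zero_norm_sub_le hsurj hH0
  obtain ⟨L, s, hs, hL⟩ := ((hG.contDiffAt_covHess hf hy v).of_le
    (by simp : (1 : WithTop ℕ∞) ≤ ∞)).exists_lipschitzOnWith
  obtain ⟨δ, δ0, hδ⟩ := Metric.mem_nhds_iff.1 (inter_mem hs hQ)
  have htend : Tendsto (fun z ↦ C * ‖H z‖) (𝓝 (y, v)) (𝓝 0) := by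
    have := (hstrict.continuousAt.norm).const_mul C
    simpa [ContinuousAt, hH0] using this
  -- `L` is the Lipschitz constant of the Hessian and `C` the regularity constant of `H`. The
  -- Hessian at `z` exceeds its nonpositive value at a nearby zero `z'` of `H` by at most `L * ‖z' -
  -- z‖`.
  refine ⟨L * C, ?_⟩
  filter_upwards [hC, Metric.ball_mem_nhds _ (half_pos δ0),
    htend.eventually (gt_mem_nhds (half_pos δ0))] with z hz hzb hzC hnull
  obtain ⟨z', hz0, hzz⟩ := hz
  have hz'b : z' ∈ Metric.ball (y, v) δ := by
    rw [Metric.mem_ball] at hzb ⊢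
    have := dist_triangle z' z (y, v)
    rw [dist_eq_norm z' z] at this
    linarith
  have hzb' : z ∈ Metric.ball (y, v) δ := Metric.ball_subset_ball (by linarith) hzb
  obtain ⟨e1, e2, e3⟩ : f z'.1 = 0 ∧ fderiv ℝ f z'.1 z'.2 = 0 ∧ G z'.1 z'.2 z'.2 = 0 := by
    simpa [H, Prod.ext_iff] using hz0
  have hQ' := (hδ hz'b).2 e1 e2 e3
  have hlip := hL.dist_le_mul z (hδ hzb').1 z' (hδ hz'b).1
  rw [Real.dist_eq, dist_comm, dist_eq_norm] at hlip
  have hHz : ‖H z‖ ≤ |f z.1| + |fderiv ℝ f z.1 z.2| := by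
    simp only [H, hnull, Prod.norm_def, Real.norm_eq_abs, abs_zero]
    refine max_le ?_ (max_le ?_ ?_) <;> linarith [abs_nonneg (f z.1), abs_nonneg (fderiv ℝ f z.1 z.2)]
  have habs := le_abs_self (covHess G f z.1 z.2 - covHess G f z'.1 z'.2)
  calc covHess G f z.1 z.2 ≤ L * ‖z' - z‖ := by linarith
    _ ≤ L * (C * (|f z.1| + |fderiv ℝ f z.1 z.2|)) := by
        gcongr
        exact hzz.trans (by gcongr)
    _ = _ := by ring

/-- Existence of null geodesics with given initial data. -/
theorem exists_null_geodesic (hG : IsLorentzField G O) {y k : E} (hy : y ∈ O)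
    (hk : G y k k = 0) :
    ∃ x : ℝ → E, x 0 = y ∧ deriv x 0 = k ∧ ∀ᶠ t in 𝓝 (0 : ℝ), x t ∈ O ∧ CoordGeodesicAt G x t ∧
      G (x t) (deriv x t) (deriv x t) = 0 := by
  let F : E × E → E × E := fun z ↦ (z.2, -((G z.1).inverse (firstKind G z.1 z.2 z.2)))
  have hF : ContDiffAt ℝ 1 F (y, k) := by
    have h1 : ContDiffAt ℝ ∞ (fun z : E × E ↦ (G z.1).inverse) (y, k) :=
      ContDiffAt.comp (g := fun x ↦ (G x).inverse) (y, k)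
        ((hG.isLorentzForm y hy).isInvertible.contDiffAt_map_inverse.comp y (hG.contDiffAt hy))
        contDiffAt_fst
    have : ContDiffAt ℝ ∞ F (y, k) :=
      contDiffAt_snd.prodMk (h1.clm_apply (hG.contDiffAt_firstKind hy k)).neg
    exact this.of_le (by simp)
  obtain ⟨α, hα0, ε, ε0, hα⟩ :=
    hF.exists_forall_mem_closedBall_exists_eq_forall_mem_Ioo_hasDerivAt₀ 0
  rw [zero_sub, zero_add] at hα
  have hαc : ContinuousAt α 0 := (hα 0 ⟨by linarith, ε0⟩).continuousAt
  have hαO : ∀ᶠ t in 𝓝 (0 : ℝ), (α t).1 ∈ O := by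
    have : Tendsto (fun t ↦ (α t).1) (𝓝 0) (𝓝 y) := by
      simpa [ContinuousAt, hα0] using hαc.fst
    exact this.eventually (hG.isOpen.mem_nhds hy)
  obtain ⟨δ, δ0, hδ⟩ := Metric.eventually_nhds_iff.1 hαO
  set η := min δ ε with hη
  have η0 : 0 < η := lt_min δ0 ε0
  have hI : ∀ t ∈ Ioo (-η) η, t ∈ Ioo (-ε) ε ∧ (α t).1 ∈ O := by
    intro t ht
    refine ⟨⟨by linarith [min_le_right δ ε, ht.1], ht.2.trans_le (min_le_right _ _)⟩, hδ ?_⟩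
    rw [Real.dist_eq, sub_zero, abs_lt]
    exact ⟨by linarith [min_le_left δ ε, ht.1], ht.2.trans_le (min_le_left _ _)⟩
  have hd1 : ∀ t ∈ Ioo (-η) η, HasDerivAt (fun t ↦ (α t).1) (α t).2 t := fun t ht ↦ by
    have := (hasFDerivAt_fst (𝕜 := ℝ) (p := α t)).comp_hasDerivAt t (hα t (hI t ht).1)
    exact this
  have hd2 : ∀ t ∈ Ioo (-η) η, HasDerivAt (fun t ↦ (α t).2)
      (-((G (α t).1).inverse (firstKind G (α t).1 (α t).2 (α t).2))) t := fun t ht ↦ by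
    have := (hasFDerivAt_snd (𝕜 := ℝ) (p := α t)).comp_hasDerivAt t (hα t (hI t ht).1)
    exact this
  have hderiv : ∀ t ∈ Ioo (-η) η, deriv (fun t ↦ (α t).1) =ᶠ[𝓝 t] fun t ↦ (α t).2 := by
    intro t ht
    filter_upwards [Ioo_mem_nhds ht.1 ht.2] with s hs
    exact (hd1 s hs).deriv
  have hgeo : ∀ t ∈ Ioo (-η) η, ∀ w, G (α t).1
      (-((G (α t).1).inverse (firstKind G (α t).1 (α t).2 (α t).2))) w +
      firstKind G (α t).1 (α t).2 (α t).2 w = 0 := by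
    intro t ht w
    obtain ⟨M, hM⟩ := (hG.isLorentzForm _ (hI t ht).2).isInvertible
    rw [← hM]
    simp
  -- Conservation of the norm: with three equal arguments the Christoffel symbol is half the
  -- derivative of `G`, so the geodesic equation paired with the velocity cancels the whole
  -- derivative.
  have hnull : ∀ t ∈ Ioo (-η) η, HasDerivAt (fun t ↦ G (α t).1 (α t).2 (α t).2) 0 t := by
    intro t ht
    have hGd := (hG.differentiableAt (hI t ht).2).hasFDerivAt.comp_hasDerivAt t (hd1 t ht)
    have := (hGd.clm_apply (hd2 t ht)).clm_apply (hd2 t ht)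
    refine this.congr_deriv ?_
    have h1 := hgeo t ht (α t).2
    rw [firstKind_apply] at h1
    have h2 := (hG.isLorentzForm _ (hI t ht).2).1 (α t).2
      (-((G (α t).1).inverse (firstKind G (α t).1 (α t).2 (α t).2)))
    simp only [Function.comp_apply, add_apply]
    linarith
  have h0mem : (0 : ℝ) ∈ Ioo (-η) η := ⟨by linarith, η0⟩
  refine ⟨fun t ↦ (α t).1, by simp [hα0], by rw [(hd1 0 h0mem).deriv, hα0], ?_⟩
  filter_upwards [Ioo_mem_nhds h0mem.1 h0mem.2] with t ht
  refine ⟨(hI t ht).2, ⟨(hd1 t ht).differentiableAt, ?_, ?_⟩, ?_⟩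
  · exact (hderiv t ht).symm.differentiableAt_iff.1 (hd2 t ht).differentiableAt
  · intro w
    rw [(hderiv t ht).deriv_eq, (hd2 t ht).deriv, (hd1 t ht).deriv]
    exact hgeo t ht w
  · rw [(hd1 t ht).deriv]
    have := (convex_Ioo (-η) η).norm_image_sub_le_of_norm_hasDerivWithin_le (C := 0)
      (f := fun t ↦ G (α t).1 (α t).2 (α t).2) (f' := fun _ ↦ 0)
      (fun x hx ↦ (hnull x hx).hasDerivWithinAt) (by simp) h0mem ht
    simpa [hα0, hk] using this

/-- On a vector `k` tangent to the zero set of `f`, half of the Lie derivative of `g - R♭ ⊗ R♭`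
along a unit normal `R` is the covariant Hessian of `f` divided by the normal derivative of `f`. -/
theorem lieDerivTensor_unitNormal {G : E4 → E4 →L[ℝ] E4 →L[ℝ] ℝ} {O : Set E4} {f : E4 → ℝ}
    {R : E4 → E4} {y k : E4} (hG : IsLorentzField G O) (hf : ContDiffOn ℝ ∞ f O) (hy : y ∈ O)
    (hfy : f y = 0) (hdf : fderiv ℝ f y ≠ 0) (hk : fderiv ℝ f y k = 0)
    (hR : DifferentiableAt ℝ R y) (hunit : ∀ᶠ z in 𝓝 y, f z = 0 → G z (R z) (R z) = 1)
    (hnormal : ∀ᶠ z in 𝓝 y, f z = 0 → ∀ v, fderiv ℝ f z v = 0 → G z (R z) v = 0) :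
    fderiv ℝ f y (R y) ≠ 0 ∧
    Spacetime.lieDerivTensor R (fun z v w ↦ G z v w - G z (R z) v * G z (R z) w) y k k / 2 =
      covHess G f y k / fderiv ℝ f y (R y) := by
  have hfy' := hf.contDiffAt (hG.isOpen.mem_nhds hy)
  have hf2 : DifferentiableAt ℝ (fderiv ℝ f) y :=
    (hfy'.fderiv_right (m := ∞) (by simp)).differentiableAt (by simp)
  -- On the zero set the covector dual to `R` vanishes on the kernel of `df`, so it is a multiple of
  -- `df`; evaluation at `R` gives the factor.
  have hdecomp : ∀ᶠ z in 𝓝 y, f z = 0 → fderiv ℝ f z (R z) ≠ 0 ∧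
      ∀ v, G z (R z) v = fderiv ℝ f z v / fderiv ℝ f z (R z) := by
    filter_upwards [hunit, hnormal] with z h1 h2 hz
    have hne : fderiv ℝ f z (R z) ≠ 0 := fun h ↦ by
      have := h2 hz _ h
      rw [h1 hz] at this
      exact one_ne_zero this
    refine ⟨hne, fun v ↦ ?_⟩
    have h3 := h2 hz (v - (fderiv ℝ f z v / fderiv ℝ f z (R z)) • R z) (by simp [hne])
    rw [map_sub, map_smul, h1 hz, sub_eq_zero] at h3
    simpa using h3
  obtain ⟨hne, hyv⟩ := hdecomp.self_of_nhds hfy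
  refine ⟨hne, ?_⟩
  have hGRk : G y (R y) k = 0 := by rw [hyv, hk, zero_div]
  -- `R` is known to be unit and normal only on the zero set, so that relation may be differentiated
  -- only along a curve inside it. Computing the derivative of `G(R, k)` along `c` in two ways
  -- relates `G(∂_k R, k)` to the second derivative of `f`; the derivative of the denominator drops
  -- out because `df(k) = 0`.
  obtain ⟨c, hc0, hc, hcf⟩ := (hfy'.hasStrictFDerivAt (by simp)).exists_curve_in_zero_set hdf hfy hk
  have hct : Tendsto c (𝓝 0) (𝓝 y) := by simpa [ContinuousAt, hc0] using hc.continuousAt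
  have ha : HasFDerivAt (fun z ↦ G z (R z) k) _ y :=
    ((hG.differentiableAt hy).hasFDerivAt.clm_apply hR.hasFDerivAt).clm_apply (hasFDerivAt_const k y)
  have hcurve : HasDerivAt (fun t ↦ G (c t) (R (c t)) k)
      (fderiv ℝ (fderiv ℝ f) y k k / fderiv ℝ f y (R y)) 0 := by
    have e : (fun t ↦ G (c t) (R (c t)) k) =ᶠ[𝓝 0]
        fun t ↦ fderiv ℝ f (c t) k / fderiv ℝ f (c t) (R (c t)) := by
      filter_upwards [hct.eventually hdecomp, hcf] with t h1 h2
      exact (h1 h2).2 k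
    have hfc : HasDerivAt (fun t ↦ fderiv ℝ f (c t)) (fderiv ℝ (fderiv ℝ f) y k) 0 := by
      have : HasFDerivAt (fderiv ℝ f) (fderiv ℝ (fderiv ℝ f) y) (c 0) := by
        rw [hc0]; exact hf2.hasFDerivAt
      exact this.comp_hasDerivAt 0 hc
    have hRc : HasDerivAt (fun t ↦ R (c t)) (fderiv ℝ R y k) 0 := by
      have : HasFDerivAt R (fderiv ℝ R y) (c 0) := by
        rw [hc0]; exact hR.hasFDerivAt
      exact this.comp_hasDerivAt 0 hc
    have h1 : HasDerivAt (fun t ↦ fderiv ℝ f (c t) k) (fderiv ℝ (fderiv ℝ f) y k k) 0 := by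
      simpa using hfc.clm_apply (hasDerivAt_const (0 : ℝ) k)
    have h2 := h1.fun_div (hfc.clm_apply hRc) (by rw [hc0]; exact hne)
    refine (h2.congr_of_eventuallyEq e).congr_deriv ?_
    rw [hc0, hk, zero_mul, sub_zero]
    field_simp
  have hcurve' : HasDerivAt (fun t ↦ G (c t) (R (c t)) k)
      (fderiv ℝ G y k (R y) k + G y (fderiv ℝ R y k) k) 0 := by
    have ha' := ha
    rw [← hc0] at ha'
    refine (ha'.comp_hasDerivAt 0 hc).congr_deriv ?_
    simp [hc0]
    ring
  have hkey := hcurve.unique hcurve'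
  -- The subtracted square vanishes to second order, since `G(R, k) = 0` at `y`.
  have hT : fderiv ℝ (fun z ↦ G z k k - G z (R z) k * G z (R z) k) y (R y) =
      fderiv ℝ G y (R y) k k := by
    have h1 := ((hG.differentiableAt hy).hasFDerivAt.clm_apply
      (hasFDerivAt_const k y)).clm_apply (hasFDerivAt_const k y)
    rw [(h1.fun_sub (ha.fun_mul ha)).fderiv]
    simp [hGRk]
  have hgrad : R y = (fderiv ℝ f y (R y))⁻¹ • metricGrad G f y := by
    apply (hG.isLorentzForm y hy).injective
    ext v
    rw [hyv, map_smul, smul_apply, hG.apply_metricGrad hy, smul_eq_mul]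
    ring
  have hΓ : firstKind G y k k (R y) =
      firstKind G y k k (metricGrad G f y) / fderiv ℝ f y (R y) := by
    conv_lhs => rw [hgrad]
    rw [map_smul, smul_eq_mul]
    ring
  rw [Spacetime.lieDerivTensor, hT, covHess, sub_div, ← hΓ, hkey, firstKind_apply, hGRk,
    hG.fderiv_symm hy k k (R y), (hG.isLorentzForm y hy).1 k (fderiv ℝ R y k)]
  ring

/-- The normalized gradient of a function with spacelike gradient. -/
theorem contDiffAt_unitGrad (hG : IsLorentzField G O) (hf : ContDiffOn ℝ ∞ f O) {y : E}
    (hy : y ∈ O) (hpos : 0 < G y (metricGrad G f y) (metricGrad G f y)) :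
    ContDiffAt ℝ ∞ (fun z ↦ (√(G z (metricGrad G f z) (metricGrad G f z)))⁻¹ • metricGrad G f z)
      y := by
  have h1 := hG.contDiffAt_metricGrad hf hy
  have h2 := ((hG.contDiffAt hy).clm_apply h1).clm_apply h1
  exact ((h2.sqrt hpos.ne').inv (Real.sqrt_pos.2 hpos).ne').smul h1

end Coordinates

namespace Spacetime

/-! ### Passage between the manifold and its charts: tangent vectors, metric, geodesic equation. -/

section Charts

set_option maxSynthPendingDepth 3

variable {M : Type*} [TopologicalSpace M] [ChartedSpace E4 M] {e : OpenPartialHomeomorph M E4}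

theorem HasInitialVelocity.continuousAt {c : ℝ → M}
    {p : M} {v : TangentSpace (𝓡 4) p} (hc : HasInitialVelocity c p v) :
    Tendsto c (𝓝 0) (𝓝 p) := by
  obtain ⟨rfl, hd⟩ := hc
  exact hd.continuousAt

theorem mdifferentiable_of_mem_maximalAtlas (he : e ∈ IsManifold.maximalAtlas (𝓡 4) ∞ M) :
    e.MDifferentiable (𝓡 4) (𝓡 4) :=
  ⟨(contMDiffOn_of_mem_maximalAtlas he).mdifferentiableOn (by simp),
    (contMDiffOn_symm_of_mem_maximalAtlas he).mdifferentiableOn (by simp)⟩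


theorem toCoord_ofCoord (he : e ∈ IsManifold.maximalAtlas (𝓡 4) ∞ M) {y : E4} (hy : y ∈ e.target)
    (v : E4) : toCoord e (e.symm y) (ofCoord e y v) = v :=
  DFunLike.congr_fun ((mdifferentiable_of_mem_maximalAtlas he).comp_symm_deriv hy) v

theorem ofCoord_toCoord (he : e ∈ IsManifold.maximalAtlas (𝓡 4) ∞ M) {x : M} (hx : x ∈ e.source)
    (v : TangentSpace (𝓡 4) x) : (ofCoord e (e x) (toCoord e x v) : E4) = v :=
  DFunLike.congr_fun ((mdifferentiable_of_mem_maximalAtlas he).symm_comp_deriv hx) v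

theorem HasInitialVelocity.hasDerivAt (he : e ∈ IsManifold.maximalAtlas (𝓡 4) ∞ M) {c : ℝ → M}
    {p : M} {v : TangentSpace (𝓡 4) p} (hc : HasInitialVelocity c p v) (hp : p ∈ e.source) :
    HasDerivAt (fun t ↦ e (c t)) (toCoord e p v) 0 := by
  obtain ⟨rfl, hd⟩ := hc
  have h1 := ((mdifferentiable_of_mem_maximalAtlas he).mdifferentiableAt hp).hasMFDerivAt
  have h2 : HasFDerivAt (fun t ↦ e (c t)) (ContinuousLinearMap.comp (M₁ := ℝ) (M₂ := E4) (M₃ := E4)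
      (toCoord e (c 0)) (ContinuousLinearMap.toSpanSingleton ℝ (M₁ := E4) v)) 0 :=
    (h1.comp 0 hd).hasFDerivAt
  refine h2.hasDerivAt.congr_deriv ?_
  change toCoord e (c 0) ((1 : ℝ) • (v : E4)) = _
  rw [one_smul]

theorem hasInitialVelocity_symm (he : e ∈ IsManifold.maximalAtlas (𝓡 4) ∞ M) {x : ℝ → E4} {y w : E4}
    (hy : y ∈ e.target) (h0 : x 0 = y) (hx : HasDerivAt x w 0) :
    HasInitialVelocity (fun t ↦ e.symm (x t)) (e.symm y) (ofCoord e y w) := by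
  subst h0
  refine ⟨rfl, ?_⟩
  have h1 := ((mdifferentiable_of_mem_maximalAtlas he).mdifferentiableAt_symm hy).hasMFDerivAt
  have h2 := h1.comp 0 hx.hasFDerivAt.hasMFDerivAt
  let L : E4 →L[ℝ] E4 := ofCoord e (x 0)
  have h3 : L.comp (ContinuousLinearMap.toSpanSingleton ℝ w) =
      ContinuousLinearMap.toSpanSingleton ℝ (L w) := by
    ext
    simp
  exact (congrArg (fun D : ℝ →L[ℝ] E4 ↦
    HasMFDerivAt 𝓘(ℝ, ℝ) (𝓡 4) (fun t ↦ e.symm (x t)) 0 D) h3).mp h2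

theorem mdifferentiableAt_of_chart (he : e ∈ IsManifold.maximalAtlas (𝓡 4) ∞ M) {γ : ℝ → M} {t : ℝ}
    (hs : ∀ᶠ s in 𝓝 t, γ s ∈ e.source) (hd : DifferentiableAt ℝ (fun s ↦ e (γ s)) t) :
    MDifferentiableAt 𝓘(ℝ, ℝ) (𝓡 4) γ t := by
  have h0 : e (γ t) ∈ e.target := e.map_source hs.self_of_nhds
  have h1 := (mdifferentiable_of_mem_maximalAtlas he).mdifferentiableAt_symm h0
  have h2 : MDifferentiableAt 𝓘(ℝ, ℝ) (𝓡 4) (e.symm ∘ fun s ↦ e (γ s)) t :=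
    MDifferentiableAt.comp t h1 hd.mdifferentiableAt
  refine h2.congr_of_eventuallyEq ?_
  filter_upwards [hs] with s hs
  exact (e.left_inv hs).symm

theorem toCoord_velocity (he : e ∈ IsManifold.maximalAtlas (𝓡 4) ∞ M) {γ : ℝ → M} {t : ℝ}
    (hs : γ t ∈ e.source) (hd : MDifferentiableAt 𝓘(ℝ, ℝ) (𝓡 4) γ t) :
    toCoord e (γ t) (velocity γ t) = deriv (fun s ↦ e (γ s)) t := by
  have h1 := ((mdifferentiable_of_mem_maximalAtlas he).mdifferentiableAt hs).hasMFDerivAt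
  have h2 : HasFDerivAt (fun s ↦ e (γ s)) (ContinuousLinearMap.comp (M₁ := ℝ) (M₂ := E4) (M₃ := E4)
      (toCoord e (γ t)) (mfderiv 𝓘(ℝ, ℝ) (𝓡 4) γ t)) t :=
    (h1.comp t hd.hasMFDerivAt).hasFDerivAt
  exact h2.hasDerivAt.deriv.symm

variable [IsManifold (𝓡 4) ∞ M]

/-- A smooth coordinate vector field gives a smooth vector field along the inverse chart. -/
theorem contMDiffOn_ofCoord (he : e ∈ IsManifold.maximalAtlas (𝓡 4) ∞ M) {N : Set E4}
    (hN : N ⊆ e.target) {R : E4 → E4} (hR : ContDiffOn ℝ ∞ R N) :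
    ContMDiffOn (𝓡 4) ((𝓡 4).prod (𝓡 4)) ∞
      (fun y : E4 ↦ Bundle.TotalSpace.mk' E4 (E := fun x : M ↦ TangentSpace (𝓡 4) x)
        (e.symm y) (ofCoord e y (R y))) N := by
  have h1 : ContMDiffOn (𝓡 4) ((𝓡 4).prod (𝓡 4)) ∞
      (fun y : E4 ↦ (⟨y, R y⟩ : TangentBundle (𝓡 4) E4)) N :=
    fun y hy ↦ contMDiffWithinAt_vectorSpace_iff_contDiffWithinAt.2 (hR y hy)
  have h2 := (contMDiffOn_symm_of_mem_maximalAtlas he).contMDiffOn_tangentMapWithin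
    (m := ∞) (by simp) e.open_target.uniqueMDiffOn
  refine (h2.comp h1 fun y hy ↦ hN hy).congr fun y hy ↦ ?_
  simp only [Function.comp_apply, tangentMapWithin, ofCoord]
  rw [mfderivWithin_of_isOpen e.open_target (hN hy)]
  rfl

theorem contMDiffOn_ofCoord_section (he : e ∈ IsManifold.maximalAtlas (𝓡 4) ∞ M) {N : Set E4}
    (hN : N ⊆ e.target) {R : E4 → E4} (hR : ContDiffOn ℝ ∞ R N) :
    ContMDiffOn (𝓡 4) ((𝓡 4).prod (𝓡 4)) ∞
      (fun x : M ↦ Bundle.TotalSpace.mk' E4 (E := fun x : M ↦ TangentSpace (𝓡 4) x)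
        x (ofCoord e (e x) (R (e x)))) (e.source ∩ e ⁻¹' N) := by
  have h := (contMDiffOn_ofCoord he hN hR).comp
    ((contMDiffOn_of_mem_maximalAtlas he).mono inter_subset_left)
    (fun x (hx : x ∈ e.source ∩ e ⁻¹' N) ↦ hx.2)
  refine h.congr fun x hx ↦ ?_
  -- The base points `e.symm (e x)` and `x` are equal but give different tangent space types.
  -- Generalizing over an equal point lets the equality be eliminated; the same device recurs below.
  have key : ∀ (x' : M) (w : E4), x' = x →
      Bundle.TotalSpace.mk' E4 (E := fun x : M ↦ TangentSpace (𝓡 4) x) x w =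
      Bundle.TotalSpace.mk' E4 (E := fun x : M ↦ TangentSpace (𝓡 4) x) x' w := by
    rintro _ w rfl; rfl
  exact key _ _ (e.left_inv hx.1)

/-- The metric read in a chart, as a field of continuous bilinear forms. -/
def metricForm (g : LorentzianMetric M) (e : OpenPartialHomeomorph M E4) (y : E4) :
    E4 →L[ℝ] E4 →L[ℝ] ℝ :=
  ContinuousLinearMap.bilinearComp (E := E4) (F := E4) (E' := E4) (F' := E4)
    (g.val (e.symm y)) (ofCoord e y) (ofCoord e y)

theorem metricForm_apply (g : LorentzianMetric M) (e : OpenPartialHomeomorph M E4) (y v w : E4) :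
    metricForm g e y v w = chartMetric g e y v w := rfl

theorem metricForm_toCoord (g : LorentzianMetric M)
    (he : e ∈ IsManifold.maximalAtlas (𝓡 4) ∞ M) {x : M} (hx : x ∈ e.source)
    (v w : TangentSpace (𝓡 4) x) :
    metricForm g e (e x) (toCoord e x v) (toCoord e x w) = g.val x v w := by
  have key : ∀ (x' : M) (v' w' : E4), x' = x → v' = v → w' = w →
      g.val x' v' w' = g.val x v w := by
    rintro _ _ _ rfl rfl rfl; rfl
  exact key _ _ _ (e.left_inv hx) (ofCoord_toCoord he hx v) (ofCoord_toCoord he hx w)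

theorem isLorentzField_metricForm (g : LorentzianMetric M)
    (he : e ∈ IsManifold.maximalAtlas (𝓡 4) ∞ M) : IsLorentzField (metricForm g e) e.target where
  isOpen := e.open_target
  contDiffOn := by
    rw [contDiffOn_clm_apply]
    intro v
    rw [contDiffOn_clm_apply]
    intro w
    have hψ := g.contMDiff.comp_contMDiffOn (contMDiffOn_symm_of_mem_maximalAtlas he)
    have h := ContMDiffOn.clm_bundle_apply₂ (F₁ := E4) (F₂ := E4) (F₃ := ℝ)
      (E₁ := fun x : M ↦ TangentSpace (𝓡 4) x) (E₂ := fun x : M ↦ TangentSpace (𝓡 4) x)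
      (E₃ := fun _ : M ↦ ℝ)
      hψ (contMDiffOn_ofCoord he subset_rfl (contDiffOn_const (c := v)))
      (contMDiffOn_ofCoord he subset_rfl (contDiffOn_const (c := w)))
    have h' : ContMDiffOn (𝓡 4) 𝓘(ℝ, ℝ) ∞ (fun y ↦ metricForm g e y v w) e.target := by
      intro y hy
      exact ((Bundle.contMDiffWithinAt_totalSpace).1 (h y hy)).2
    exact h'.contDiffOn
  isLorentzForm y hy := by
    refine ⟨fun v w ↦ g.symm _ _ _, ?_⟩
    obtain ⟨T, hT, hpos⟩ := g.lorentzian (e.symm y)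
    have hT' : (ofCoord e y (toCoord e (e.symm y) T) : E4) = T := by
      have := ofCoord_toCoord he (e.map_target hy) T
      rwa [e.right_inv hy] at this
    refine ⟨toCoord e (e.symm y) T, ?_, fun v hv hv0 ↦ ?_⟩
    · rw [metricForm_apply, chartMetric]
      erw [hT']
      exact hT
    · rw [metricForm_apply, chartMetric] at hv ⊢
      erw [hT'] at hv
      refine hpos _ hv fun h ↦ hv0 ?_
      rw [← toCoord_ofCoord he hy v, h, map_zero]

theorem christoffel_eq (g : LorentzianMetric M) (he : e ∈ IsManifold.maximalAtlas (𝓡 4) ∞ M)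
    {y : E4} (hy : y ∈ e.target) (u v w : E4) :
    christoffel g e y u v w = firstKind (metricForm g e) y u v w := by
  have hG := isLorentzField_metricForm g he
  rw [firstKind_apply, ← hG.fderiv_apply₂ hy, ← hG.fderiv_apply₂ hy, ← hG.fderiv_apply₂ hy]
  rfl

theorem geodesicEqAt_iff (g : LorentzianMetric M) (he : e ∈ IsManifold.maximalAtlas (𝓡 4) ∞ M)
    {x : ℝ → E4} {t : ℝ} (hx : x t ∈ e.target) :
    GeodesicEqAt g e x t ↔ CoordGeodesicAt (metricForm g e) x t := by
  simp only [GeodesicEqAt, CoordGeodesicAt, christoffel_eq g he hx, metricForm_apply]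

/-- The generator of a flow read in a chart. -/
def chartGenerator (φ : ℝ → M → M) (e : OpenPartialHomeomorph M E4) (y : E4) : E4 :=
  toCoord e (e.symm y) (generator φ (e.symm y))

end Charts

/-! ### Flow-invariant geometry: projection to the slice and local defining functions of the
surface. -/

section Stationary

set_option maxSynthPendingDepth 3

variable {M : Type*} [TopologicalSpace M] [ChartedSpace E4 M] {φ : ℝ → M → M} {τ : M → ℝ} {c : ℝ}

/-- The projection to the slice `τ = c` along the orbits of the flow. -/
def sliceProj (φ : ℝ → M → M) (τ : M → ℝ) (c : ℝ) (x : M) : M := φ (c - τ x) x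

theorem sliceProj_mem_slice (hτ : IsAdaptedTime φ τ) (x : M) :
    sliceProj φ τ c x ∈ slice τ c := by
  change τ (φ (c - τ x) x) = c
  rw [hτ.flow]
  ring

variable [IsManifold (𝓡 4) ∞ M] {g : LorentzianMetric M} {e : OpenPartialHomeomorph M E4}

theorem IsStationaryFlow.contMDiff (hφ : IsStationaryFlow g φ) (s : ℝ) :
    ContMDiff (𝓡 4) (𝓡 4) ∞ (φ s) :=
  hφ.smooth.comp (contMDiff_const.prodMk contMDiff_id)

theorem IsStationaryFlow.contMDiff_orbit (hφ : IsStationaryFlow g φ) (x : M) :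
    ContMDiff 𝓘(ℝ, ℝ) (𝓡 4) ∞ (fun s ↦ φ s x) :=
  hφ.smooth.comp (contMDiff_id.prodMk contMDiff_const)

theorem IsStationaryFlow.neg_apply (hφ : IsStationaryFlow g φ) (s : ℝ) (x : M) :
    φ (-s) (φ s x) = x := by
  rw [← hφ.add, neg_add_cancel, hφ.zero]

theorem sliceProj_flow (hφ : IsStationaryFlow g φ) (hτ : IsAdaptedTime φ τ) (s : ℝ) (x : M) :
    sliceProj φ τ c (φ s x) = sliceProj φ τ c x := by
  rw [sliceProj, sliceProj, ← hφ.add, hτ.flow]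
  congr 1
  ring

theorem sliceProj_of_mem_slice (hφ : IsStationaryFlow g φ) {x : M} (hx : x ∈ slice τ c) :
    sliceProj φ τ c x = x := by
  have : τ x = c := hx
  rw [sliceProj, this, sub_self, hφ.zero]

theorem contMDiff_sliceProj (hφ : IsStationaryFlow g φ) (hτ : IsAdaptedTime φ τ) :
    ContMDiff (𝓡 4) (𝓡 4) ∞ (sliceProj φ τ c) := by
  have h : ContMDiff (𝓡 4) 𝓘(ℝ, ℝ) ∞ (fun x ↦ c - τ x) := contMDiff_const.sub hτ.smooth
  exact hφ.smooth.comp (h.prodMk contMDiff_id)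

/-- The projection is constant on orbits and fixes the slice. Set relations in the slice thereby
lift to spacetime by taking preimages. -/
theorem transport_eq_preimage (hφ : IsStationaryFlow g φ) (hτ : IsAdaptedTime φ τ) {A : Set M}
    (hA : A ⊆ slice τ c) : transport φ A = sliceProj φ τ c ⁻¹' A := by
  ext x
  constructor
  · rintro ⟨s, y, hy, rfl⟩
    rw [mem_preimage, sliceProj_flow hφ hτ, sliceProj_of_mem_slice hφ (hA hy)]
    exact hy
  · intro hx
    exact ⟨_, _, hx, (hφ.neg_apply (c - τ x) x).symm⟩

/-- The flow time `c - τ` is stationary in the direction `v`, so the derivative agrees with that of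
the flow at the frozen time `c - τ y = 0`, which is the identity. -/
theorem mfderiv_sliceProj (hφ : IsStationaryFlow g φ) (hτ : IsAdaptedTime φ τ) {y : M}
    (hy : y ∈ slice τ c) (v : TangentSpace (𝓡 4) y) (hv : differential τ y v = 0) :
    (mfderiv (𝓡 4) (𝓡 4) (sliceProj φ τ c) y v : E4) = v := by
  have hy' : c - τ y = 0 := sub_eq_zero.2 (Eq.symm hy)
  have hs : MDifferentiableAt (𝓡 4) 𝓘(ℝ, ℝ) (fun x ↦ c - τ x) y :=
    ((contMDiff_const.sub hτ.smooth).mdifferentiable (by simp)) y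
  have hds : mfderiv (𝓡 4) 𝓘(ℝ, ℝ) (fun x ↦ c - τ x) y v = (0 : ℝ) := by
    have h1 := (hasMFDerivAt_const (I := 𝓡 4) (I' := 𝓘(ℝ, ℝ)) c y).sub
      (hτ.smooth.mdifferentiable (by simp) y).hasMFDerivAt
    have h2 := h1.mfderiv
    have h3 : mfderiv (𝓡 4) 𝓘(ℝ, ℝ) (fun x ↦ c - τ x) y v =
      (0 : ℝ) - differential τ y v := DFunLike.congr_fun h2 v
    rw [h3, hv, sub_zero]
  have hΦ : MDifferentiable (𝓘(ℝ, ℝ).prod (𝓡 4)) (𝓡 4) (fun q : ℝ × M ↦ φ q.1 q.2) :=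
    hφ.smooth.mdifferentiable (by simp)
  have hid : HasMFDerivAt (𝓡 4) (𝓡 4) (fun x : M ↦ x) y (ContinuousLinearMap.id ℝ _) :=
    hasMFDerivAt_id y
  have hA : HasMFDerivAt (𝓡 4) (𝓡 4) (sliceProj φ τ c) y _ :=
    HasMFDerivAt.comp (g := fun q : ℝ × M ↦ φ q.1 q.2) (f := fun x ↦ (c - τ x, x)) y
      (hΦ (c - τ y, y)).hasMFDerivAt (hs.hasMFDerivAt.prodMk hid)
  have hB : HasMFDerivAt (𝓡 4) (𝓡 4) (φ (c - τ y)) y _ :=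
    HasMFDerivAt.comp (g := fun q : ℝ × M ↦ φ q.1 q.2) (f := fun x ↦ (c - τ y, x)) y
      (hΦ (c - τ y, y)).hasMFDerivAt
      ((hasMFDerivAt_const (I := 𝓡 4) (I' := 𝓘(ℝ, ℝ)) (c - τ y) y).prodMk hid)
  have hφ0 : φ (c - τ y) = fun x ↦ x := by
    rw [hy']; exact funext hφ.zero
  have hC : (mfderiv (𝓡 4) (𝓡 4) (φ (c - τ y)) y v : E4) = v := by
    rw [hφ0]
    exact DFunLike.congr_fun hid.mfderiv v
  have e1 : (mfderiv (𝓡 4) (𝓡 4) (sliceProj φ τ c) y v : E4) =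
      mfderiv (𝓘(ℝ, ℝ).prod (𝓡 4)) (𝓡 4) (fun q : ℝ × M ↦ φ q.1 q.2) (c - τ y, y)
        ((mfderiv (𝓡 4) 𝓘(ℝ, ℝ) (fun x ↦ c - τ x) y v : ℝ), (v : E4)) :=
    DFunLike.congr_fun hA.mfderiv v
  have e2 : (mfderiv (𝓡 4) (𝓡 4) (φ (c - τ y)) y v : E4) =
      mfderiv (𝓘(ℝ, ℝ).prod (𝓡 4)) (𝓡 4) (fun q : ℝ × M ↦ φ q.1 q.2) (c - τ y, y)
        ((0 : ℝ), (v : E4)) :=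
    DFunLike.congr_fun hB.mfderiv v
  rw [e1, hds, ← e2, hC]

/-- The transported surface is locally the zero set of a flow-invariant function with nonvanishing
differential. -/
theorem exists_invariant_function (hφ : IsStationaryFlow g φ) (hτ : IsAdaptedTime φ τ) {S₀ : Set M}
    (hS₀ : IsEmbeddedSurfaceInSlice τ c S₀) {p : M} (hp : p ∈ transport φ S₀) :
    ∃ (V : Set M) (F : M → ℝ), IsOpen V ∧ p ∈ V ∧ ContMDiffOn (𝓡 4) 𝓘(ℝ, ℝ) ∞ F V ∧
      (∀ s x, F (φ s x) = F x) ∧ (∀ x ∈ V, F x = 0 ↔ x ∈ transport φ S₀) ∧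
      ∃ v : TangentSpace (𝓡 4) p, differential F p v ≠ 0 := by
  have htr := transport_eq_preimage hφ hτ hS₀.1
  obtain ⟨s, y, hy, rfl⟩ := hp
  obtain ⟨U, f, hU, hyU, hf, hSU, v, hv, hfv⟩ := hS₀.2 y hy
  have hys := hS₀.1 hy
  have hπ := contMDiff_sliceProj (c := c) hφ hτ
  have hπy : sliceProj φ τ c y = y := sliceProj_of_mem_slice hφ hys
  have hF : ContMDiffOn (𝓡 4) 𝓘(ℝ, ℝ) ∞ (fun x ↦ f (sliceProj φ τ c x))
      (sliceProj φ τ c ⁻¹' U) := hf.comp hπ.contMDiffOn subset_rfl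
  have hopen : IsOpen (sliceProj φ τ c ⁻¹' U) := hU.preimage hπ.continuous
  have hmem : φ s y ∈ sliceProj φ τ c ⁻¹' U := by
    rw [mem_preimage, sliceProj_flow hφ hτ, hπy]
    exact hyU
  refine ⟨sliceProj φ τ c ⁻¹' U, fun x ↦ f (sliceProj φ τ c x), hopen, hmem, hF,
    fun s x ↦ congrArg f (sliceProj_flow hφ hτ s x), fun x hx ↦ ?_, ?_⟩
  · rw [htr, mem_preimage]
    have h1 : sliceProj φ τ c x ∈ S₀ ∩ U ↔ sliceProj φ τ c x ∈ U ∧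
        sliceProj φ τ c x ∈ slice τ c ∧ f (sliceProj φ τ c x) = 0 := by rw [hSU]; exact Iff.rfl
    have h2 : sliceProj φ τ c x ∈ slice τ c := sliceProj_mem_slice hτ x
    have hx' : sliceProj φ τ c x ∈ U := hx
    constructor
    · exact fun h ↦ (h1.2 ⟨hx', h2, h⟩).1
    · exact fun h ↦ (h1.1 ⟨h, hx'⟩).2.2
  -- Invariance under `φ s` moves the computation from `φ s y` back to `y`, where the projection
  -- fixes `v` and the differential of `f` is nonzero on it.
  · refine ⟨mfderiv (𝓡 4) (𝓡 4) (φ s) y v, ?_⟩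
    have hfd : MDifferentiableAt (𝓡 4) 𝓘(ℝ, ℝ) f y :=
      ((hf y hyU).contMDiffAt (hU.mem_nhds hyU)).mdifferentiableAt (by simp)
    have hfd' : MDifferentiableAt (𝓡 4) 𝓘(ℝ, ℝ) f (sliceProj φ τ c y) := by rwa [hπy]
    have hFd : MDifferentiableAt (𝓡 4) 𝓘(ℝ, ℝ) (fun x ↦ f (sliceProj φ τ c x)) (φ s y) :=
      ((hF _ hmem).contMDiffAt (hopen.mem_nhds hmem)).mdifferentiableAt (by simp)
    have h1 : HasMFDerivAt (𝓡 4) 𝓘(ℝ, ℝ) (fun x ↦ f (sliceProj φ τ c (φ s x))) y _ :=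
      hFd.hasMFDerivAt.comp y ((hφ.contMDiff s).mdifferentiable (by simp) y).hasMFDerivAt
    have h2 : HasMFDerivAt (𝓡 4) 𝓘(ℝ, ℝ) (fun x ↦ f (sliceProj φ τ c x)) y _ :=
      hfd'.hasMFDerivAt.comp y (hπ.mdifferentiable (by simp) y).hasMFDerivAt
    have h3 : (fun x ↦ f (sliceProj φ τ c (φ s x))) = fun x ↦ f (sliceProj φ τ c x) :=
      funext fun x ↦ by rw [sliceProj_flow hφ hτ]
    rw [h3] at h1
    have h4 : differential (fun x ↦ f (sliceProj φ τ c x)) (φ s y) (mfderiv (𝓡 4) (𝓡 4) (φ s) y v) =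
      mfderiv (𝓡 4) 𝓘(ℝ, ℝ) f (sliceProj φ τ c y) (mfderiv (𝓡 4) (𝓡 4) (sliceProj φ τ c) y v) :=
      DFunLike.congr_fun (hasMFDerivAt_unique h1 h2) v
    have key : ∀ (y' : M) (w : E4), y' = y → w = v →
        (mfderiv (𝓡 4) 𝓘(ℝ, ℝ) f y' w : ℝ) = differential f y v := by
      rintro _ _ rfl rfl; rfl
    rw [h4]
    exact (key _ _ hπy (mfderiv_sliceProj hφ hτ hys v hv)).trans_ne hfv

/-- The regions of spacetime swept out by the two sides of the surface. -/
structure Separates (S In Out : Set M) : Prop where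
  open_in : IsOpen In
  open_out : IsOpen Out
  union : In ∪ S ∪ Out = univ
  disjoint_in : Disjoint In S
  disjoint_out : Disjoint Out S
  disjoint_in_out : Disjoint In Out
  boundary_in : S ⊆ closure In
  boundary_out : S ⊆ closure Out

/-- Openness, disjointness and exhaustion pull back along the continuous slice projection; the
closure conditions are pushed forward by each `φ s`. -/
theorem Divides.separates (hφ : IsStationaryFlow g φ) (hτ : IsAdaptedTime φ τ)
    {S₀ In Out : Set M} (h : Divides (slice τ c) S₀ In Out) :
    Separates (transport φ S₀) (transport φ In) (transport φ Out) := by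
  have hIn : In ⊆ slice τ c := h.union ▸ fun x hx ↦ Or.inl (Or.inl hx)
  have hS : S₀ ⊆ slice τ c := h.union ▸ fun x hx ↦ Or.inl (Or.inr hx)
  have hOut : Out ⊆ slice τ c := h.union ▸ fun x hx ↦ Or.inr hx
  have hπ := (contMDiff_sliceProj (c := c) hφ hτ).continuous
  have hopen : ∀ A : Set M, A ⊆ slice τ c → (∃ U, IsOpen U ∧ A = U ∩ slice τ c) →
      IsOpen (transport φ A) := by
    rintro A hA ⟨U, hU, hAU⟩
    rw [transport_eq_preimage hφ hτ hA, hAU, preimage_inter]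
    have : sliceProj φ τ c ⁻¹' slice τ c = univ :=
      eq_univ_of_forall fun x ↦ sliceProj_mem_slice hτ x
    rw [this, inter_univ]
    exact hU.preimage hπ
  have hclosure : ∀ A : Set M, S₀ ⊆ closure A → transport φ S₀ ⊆ closure (transport φ A) := by
    rintro A hA _ ⟨s, y, hy, rfl⟩
    exact map_mem_closure (hφ.contMDiff s).continuous (hA hy) fun z hz ↦ ⟨s, z, hz, rfl⟩
  refine ⟨hopen _ hIn h.open_in, hopen _ hOut h.open_out, ?_, ?_, ?_, ?_,
    hclosure _ h.boundary_in, hclosure _ h.boundary_out⟩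
  · rw [transport_eq_preimage hφ hτ hIn, transport_eq_preimage hφ hτ hS,
      transport_eq_preimage hφ hτ hOut, ← preimage_union, ← preimage_union, h.union]
    exact eq_univ_of_forall fun x ↦ sliceProj_mem_slice hτ x
  · rw [transport_eq_preimage hφ hτ hIn, transport_eq_preimage hφ hτ hS]
    exact h.disjoint_in.preimage _
  · rw [transport_eq_preimage hφ hτ hOut, transport_eq_preimage hφ hτ hS]
    exact h.disjoint_out.preimage _
  · rw [transport_eq_preimage hφ hτ hIn, transport_eq_preimage hφ hτ hOut]
    exact h.disjoint_in_out.preimage _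

theorem hasDerivAt_chart_orbit (hφ : IsStationaryFlow g φ)
    (he : e ∈ IsManifold.maximalAtlas (𝓡 4) ∞ M) {x : M} (hx : x ∈ e.source) :
    HasDerivAt (fun s ↦ e (φ s x)) (toCoord e x (generator φ x)) 0 := by
  have hd : MDifferentiableAt 𝓘(ℝ, ℝ) (𝓡 4) (fun s ↦ φ s x) 0 :=
    (hφ.contMDiff_orbit x).mdifferentiable (by simp) 0
  have hx0 : φ 0 x ∈ e.source := by rwa [hφ.zero]
  have hed : DifferentiableAt ℝ (fun s ↦ e (φ s x)) 0 :=
    (((mdifferentiable_of_mem_maximalAtlas he).mdifferentiableAt hx0).comp (0 : ℝ)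
      hd).differentiableAt
  have h1 := toCoord_velocity he hx0 hd
  have key : ∀ (x' : M) (w : E4), x' = x → (toCoord e x' w : E4) = toCoord e x w := by
    rintro _ w rfl; rfl
  exact hed.hasDerivAt.congr_deriv (h1.symm.trans (key _ _ (hφ.zero x)))

theorem metricForm_chartGenerator_neg (hφ : IsStationaryFlow g φ)
    (he : e ∈ IsManifold.maximalAtlas (𝓡 4) ∞ M) {y : E4} (hy : y ∈ e.target) :
    metricForm g e y (chartGenerator φ e y) (chartGenerator φ e y) < 0 := by
  have h := metricForm_toCoord g he (e.map_target hy) (generator φ (e.symm y))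
    (generator φ (e.symm y))
  rw [e.right_inv hy] at h
  exact h.trans_lt (hφ.timelike _)

/-- The generator is the time derivative at 0 of the smooth flow read in the chart. Continuity keeps
a geodesic future directed for a short time. -/
theorem continuousAt_chartGenerator (hφ : IsStationaryFlow g φ)
    (he : e ∈ IsManifold.maximalAtlas (𝓡 4) ∞ M) {y : E4} (hy : y ∈ e.target) :
    ContinuousAt (chartGenerator φ e) y := by
  let Φ : ℝ × E4 → E4 := fun q ↦ e (φ q.1 (e.symm q.2))
  have hΦ : ContDiffAt ℝ ∞ Φ (0, y) := by
    have h1 : ContMDiffAt 𝓘(ℝ, ℝ × E4) 𝓘(ℝ, ℝ) ∞ (fun q : ℝ × E4 ↦ q.1) (0, y) :=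
      contDiff_fst.contMDiff.contMDiffAt
    have h2 : ContMDiffAt 𝓘(ℝ, ℝ × E4) (𝓡 4) ∞ (fun q : ℝ × E4 ↦ q.2) (0, y) :=
      contDiff_snd.contMDiff.contMDiffAt
    have h3 : ContMDiffAt (𝓡 4) (𝓡 4) ∞ e.symm y :=
      (contMDiffOn_symm_of_mem_maximalAtlas he).contMDiffAt (e.open_target.mem_nhds hy)
    have h4 : ContMDiffAt 𝓘(ℝ, ℝ × E4) (𝓡 4) ∞ (fun q : ℝ × E4 ↦ e.symm q.2) (0, y) :=
      ContMDiffAt.comp (g := e.symm) (0, y) h3 h2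
    have h5 : ContMDiffAt 𝓘(ℝ, ℝ × E4) (𝓡 4) ∞ (fun q : ℝ × E4 ↦ φ q.1 (e.symm q.2)) (0, y) :=
      ContMDiffAt.comp (g := fun q : ℝ × M ↦ φ q.1 q.2) (0, y) hφ.smooth.contMDiffAt
        (h1.prodMk h4)
    have h6 : ContMDiffAt (𝓡 4) (𝓡 4) ∞ e (φ 0 (e.symm y)) := by
      rw [hφ.zero]
      exact (contMDiffOn_of_mem_maximalAtlas he).contMDiffAt
        (e.open_source.mem_nhds (e.map_target hy))
    have h7 : ContMDiffAt 𝓘(ℝ, ℝ × E4) (𝓡 4) ∞ Φ (0, y) :=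
      ContMDiffAt.comp (g := e) (0, y) h6 h5
    exact h7.contDiffAt
  have hev : ∀ᶠ z in 𝓝 y, fderiv ℝ Φ (0, z) (1, 0) = chartGenerator φ e z := by
    have hd : ∀ᶠ q in 𝓝 ((0 : ℝ), y), ContDiffAt ℝ 1 Φ q :=
      (hΦ.of_le (by simp : (1 : WithTop ℕ∞) ≤ ∞)).eventually (by simp)
    have ht : Tendsto (fun z : E4 ↦ ((0 : ℝ), z)) (𝓝 y) (𝓝 (0, y)) :=
      (Continuous.prodMk_right (0 : ℝ)).continuousAt
    filter_upwards [ht.eventually hd, e.open_target.mem_nhds hy] with z hz hze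
    have h1 : HasDerivAt (fun s : ℝ ↦ (s, z)) ((1 : ℝ), (0 : E4)) 0 :=
      (hasDerivAt_id 0).prodMk (hasDerivAt_const 0 z)
    have h2 := ((hz.differentiableAt (by simp)).hasFDerivAt).comp_hasDerivAt (0 : ℝ) h1
    exact h2.unique (hasDerivAt_chart_orbit hφ he (e.map_target hze))
  have hc : ContinuousAt (fun z ↦ fderiv ℝ Φ (0, z) (1, 0)) y := by
    have h1 : ContinuousAt (fderiv ℝ Φ) (0, y) :=
      (hΦ.fderiv_right (m := 0) (by simp)).continuousAt
    have h2 : ContinuousAt (fun z : E4 ↦ fderiv ℝ Φ (0, z)) y :=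
      ContinuousAt.comp (g := fderiv ℝ Φ) h1 (Continuous.prodMk_right (0 : ℝ)).continuousAt
    exact h2.clm_apply continuousAt_const
  exact hc.congr hev

/-- `f` is a regular function on the coordinate domain `O`, constant along the flow, which vanishes
on `S`, is negative on `In` and positive on `Out`. -/
structure IsDefiningFunction (φ : ℝ → M → M) (e : OpenPartialHomeomorph M E4) (S In Out : Set M)
    (f : E4 → ℝ) (O : Set E4) : Prop where
  isOpen : IsOpen O
  subset : O ⊆ e.target
  contDiffOn : ContDiffOn ℝ ∞ f O
  fderiv_ne : ∀ y ∈ O, fderiv ℝ f y ≠ 0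
  eq_zero_iff : ∀ y ∈ O, f y = 0 ↔ e.symm y ∈ S
  neg_iff : ∀ y ∈ O, f y < 0 ↔ e.symm y ∈ In
  pos_iff : ∀ y ∈ O, 0 < f y ↔ e.symm y ∈ Out
  fderiv_generator : ∀ y ∈ O, fderiv ℝ f y (chartGenerator φ e y) = 0

/-- Each side of the zero set of the invariant function is connected near `p`, so it lies wholly in
`In` or wholly in `Out`. Both regions accumulate at `p`, so the two sides lie in different regions,
and a change of sign puts `In` on the negative side. -/
theorem exists_isDefiningFunction (hφ : IsStationaryFlow g φ) (hτ : IsAdaptedTime φ τ)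
    {S₀ In Out : Set M} (hS₀ : IsEmbeddedSurfaceInSlice τ c S₀)
    (hsep : Separates (transport φ S₀) In Out) (he : e ∈ IsManifold.maximalAtlas (𝓡 4) ∞ M)
    {p : M} (hpe : p ∈ e.source) (hp : p ∈ transport φ S₀) :
    ∃ (f : E4 → ℝ) (O : Set E4), e p ∈ O ∧
      IsDefiningFunction φ e (transport φ S₀) In Out f O := by
  obtain ⟨V, F, hV, hpV, hF, hinv, hzero, v, hv⟩ := exists_invariant_function hφ hτ hS₀ hp
  set f : E4 → ℝ := fun y ↦ F (e.symm y) with hf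
  set O₁ := e.target ∩ e.symm ⁻¹' V with hO₁
  have hO₁o : IsOpen O₁ := e.isOpen_inter_preimage_symm hV
  have hpO₁ : e p ∈ O₁ := ⟨e.map_source hpe, by rwa [mem_preimage, e.left_inv hpe]⟩
  have hfO : ContDiffOn ℝ ∞ f O₁ := by
    have : ContMDiffOn (𝓡 4) 𝓘(ℝ, ℝ) ∞ f O₁ :=
      hF.comp ((contMDiffOn_symm_of_mem_maximalAtlas he).mono inter_subset_left) fun y hy ↦ hy.2
    exact this.contDiffOn
  have hfat : ∀ y ∈ O₁, ContDiffAt ℝ ∞ f y := fun y hy ↦ hfO.contDiffAt (hO₁o.mem_nhds hy)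
  have hdf : fderiv ℝ f (e p) ≠ 0 := by
    intro h
    apply hv
    have h1 := (((hfat _ hpO₁).differentiableAt (by simp)).hasFDerivAt.hasMFDerivAt).comp p
      ((mdifferentiable_of_mem_maximalAtlas he).mdifferentiableAt hpe).hasMFDerivAt
    have h2 : f ∘ e =ᶠ[𝓝 p] F := by
      filter_upwards [e.open_source.mem_nhds hpe] with x hx
      simp [hf, e.left_inv hx]
    have h3 := h2.mfderiv_eq (I := 𝓡 4) (I' := 𝓘(ℝ, ℝ))
    rw [h1.mfderiv] at h3
    have h4 : fderiv ℝ f (e p) (toCoord e p v) = differential F p v := DFunLike.congr_fun h3 v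
    rw [← h4, h]
    rfl
  have hgen : ∀ y ∈ O₁, fderiv ℝ f y (chartGenerator φ e y) = 0 := by
    intro y hy
    have hys := e.map_target hy.1
    have h1 := hasDerivAt_chart_orbit hφ he hys
    have h0 : (fun s ↦ e (φ s (e.symm y))) 0 = y := by
      simp only [hφ.zero, e.right_inv hy.1]
    have h2 : HasFDerivAt f (fderiv ℝ f y) ((fun s ↦ e (φ s (e.symm y))) 0) := by
      rw [h0]; exact ((hfat y hy).differentiableAt (by simp)).hasFDerivAt
    have h3 := h2.comp_hasDerivAt 0 h1
    refine h3.unique ((hasDerivAt_const (0 : ℝ) (f y)).congr_of_eventuallyEq ?_)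
    have hmem : ∀ᶠ s in 𝓝 (0 : ℝ), φ s (e.symm y) ∈ e.source := by
      apply (hφ.contMDiff_orbit (e.symm y)).continuous.continuousAt.preimage_mem_nhds
      rw [hφ.zero]
      exact e.open_source.mem_nhds hys
    filter_upwards [hmem] with s hs
    simp only [Function.comp_apply, hf, e.left_inv hs, hinv]
  obtain ⟨O₂, hO₂s, hO₂o, hpO₂, hO₂⟩ : ∃ O₂ ⊆ O₁, IsOpen O₂ ∧ e p ∈ O₂ ∧
      ∀ y ∈ O₂, fderiv ℝ f y ≠ 0 := by
    have hc : ContinuousAt (fderiv ℝ f) (e p) :=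
      ((hfat _ hpO₁).fderiv_right (m := 0) (by simp)).continuousAt
    obtain ⟨O₂, h1, h2, h3⟩ := mem_nhds_iff.1
      (inter_mem (hO₁o.mem_nhds hpO₁) (hc.eventually_ne hdf))
    exact ⟨O₂, fun y hy ↦ (h1 hy).1, h2, h3, fun y hy ↦ (h1 hy).2⟩
  obtain ⟨N, hNO, hNo, hpN, hNpos, hNneg⟩ := ((hfat _ hpO₁).hasStrictFDerivAt
    (by simp)).exists_nhds_isPreconnected_sides hdf (hO₂o.mem_nhds hpO₂)
  have hN1 : N ⊆ O₁ := hNO.trans hO₂s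
  have hNt : N ⊆ e.target := fun y hy ↦ (hN1 hy).1
  have hz : ∀ y ∈ N, f y = 0 ↔ e.symm y ∈ transport φ S₀ := fun y hy ↦ hzero _ (hN1 hy).2
  have hside : ∀ A ⊆ N, IsPreconnected A → (∀ y ∈ A, f y ≠ 0) →
      (∀ y ∈ A, e.symm y ∈ In) ∨ (∀ y ∈ A, e.symm y ∈ Out) := by
    intro A hA hAc hA0
    have hpre := hAc.image e.symm (e.continuousOn_symm.mono (hA.trans hNt))
    have hsub : e.symm '' A ⊆ In ∪ Out := by
      rintro _ ⟨y, hy, rfl⟩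
      have h1 : e.symm y ∈ In ∪ transport φ S₀ ∪ Out := hsep.union ▸ mem_univ _
      have h2 : e.symm y ∉ transport φ S₀ := fun h ↦ hA0 y hy ((hz y (hA hy)).2 h)
      rcases h1 with (h | h) | h
      exacts [Or.inl h, absurd h h2, Or.inr h]
    rcases hpre.subset_or_subset hsep.open_in hsep.open_out hsep.disjoint_in_out hsub with h | h
    · exact Or.inl fun y hy ↦ h ⟨y, hy, rfl⟩
    · exact Or.inr fun y hy ↦ h ⟨y, hy, rfl⟩
  have hmeet : ∀ A, transport φ S₀ ⊆ closure A → ∃ y ∈ N, e.symm y ∈ A := by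
    intro A hA
    have hW : IsOpen (e.symm '' N) := e.symm.isOpen_image_of_subset_source hNo hNt
    obtain ⟨_, ⟨y, hy, rfl⟩, h⟩ := mem_closure_iff.1 (hA hp) _ hW ⟨e p, hpN, e.left_inv hpe⟩
    exact ⟨y, hy, h⟩
  have hfinal : ∀ h : E4 → ℝ, ContDiffOn ℝ ∞ h N → (∀ y ∈ N, fderiv ℝ h y ≠ 0) →
      (∀ y ∈ N, h y = 0 ↔ f y = 0) → (∀ y ∈ N, fderiv ℝ h y (chartGenerator φ e y) = 0) →
      (∀ y ∈ N, h y < 0 → e.symm y ∈ In) → (∀ y ∈ N, 0 < h y → e.symm y ∈ Out) →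
      IsDefiningFunction φ e (transport φ S₀) In Out h N := by
    intro h h1 h2 h3 h4 h5 h6
    have hS : ∀ y ∈ N, h y = 0 → e.symm y ∈ transport φ S₀ :=
      fun y hy h0 ↦ (hz y hy).1 ((h3 y hy).1 h0)
    refine ⟨hNo, hNt, h1, h2, fun y hy ↦ (h3 y hy).trans (hz y hy), fun y hy ↦ ⟨h5 y hy, ?_⟩,
      fun y hy ↦ ⟨h6 y hy, ?_⟩, h4⟩
    · intro hin
      rcases lt_trichotomy (h y) 0 with h' | h' | h'
      · exact h'
      · exact (disjoint_left.1 hsep.disjoint_in hin (hS y hy h')).elim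
      · exact (disjoint_left.1 hsep.disjoint_in_out hin (h6 y hy h')).elim
    · intro hout
      rcases lt_trichotomy (h y) 0 with h' | h' | h'
      · exact (disjoint_left.1 hsep.disjoint_in_out (h5 y hy h') hout).elim
      · exact (disjoint_left.1 hsep.disjoint_out hout (hS y hy h')).elim
      · exact h'
  have hS0 : ∀ y ∈ N, f y = 0 → e.symm y ∉ In ∧ e.symm y ∉ Out := fun y hy h0 ↦
    ⟨fun h ↦ disjoint_left.1 hsep.disjoint_in h ((hz y hy).1 h0),
      fun h ↦ disjoint_left.1 hsep.disjoint_out h ((hz y hy).1 h0)⟩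
  -- In the first and last cases one region would have no points near `p`. The second case has the
  -- wrong orientation and uses `-f`.
  rcases hside _ (fun y hy ↦ hy.1) hNpos fun y hy ↦ hy.2.ne' with hpi | hpo <;>
    rcases hside _ (fun y hy ↦ hy.1) hNneg fun y hy ↦ hy.2.ne with hni | hno
  · obtain ⟨y, hy, hyo⟩ := hmeet _ hsep.boundary_out
    rcases lt_trichotomy (f y) 0 with h' | h' | h'
    · exact (disjoint_left.1 hsep.disjoint_in_out (hni y ⟨hy, h'⟩) hyo).elim
    · exact ((hS0 y hy h').2 hyo).elim
    · exact (disjoint_left.1 hsep.disjoint_in_out (hpi y ⟨hy, h'⟩) hyo).elim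
  · have hneg : ∀ y, fderiv ℝ (fun y ↦ -f y) y = -fderiv ℝ f y := fun y ↦ fderiv_fun_neg
    refine ⟨fun y ↦ -f y, N, hpN, hfinal _ (hfO.mono hN1).neg ?_ ?_ ?_ ?_ ?_⟩
    · intro y hy
      rw [hneg, neg_ne_zero]
      exact hO₂ y (hNO hy)
    · intro y _
      exact neg_eq_zero
    · intro y hy
      rw [hneg, neg_apply, hgen y (hN1 hy), neg_zero]
    · exact fun y hy h ↦ hpi y ⟨hy, neg_lt_zero.1 h⟩
    · exact fun y hy h ↦ hno y ⟨hy, neg_pos.1 h⟩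
  · exact ⟨f, N, hpN, hfinal f (hfO.mono hN1) (fun y hy ↦ hO₂ y (hNO hy))
      (fun _ _ ↦ Iff.rfl) (fun y hy ↦ hgen y (hN1 hy)) (fun y hy h ↦ hni y ⟨hy, h⟩)
      fun y hy h ↦ hpo y ⟨hy, h⟩⟩
  · obtain ⟨y, hy, hyi⟩ := hmeet _ hsep.boundary_in
    rcases lt_trichotomy (f y) 0 with h' | h' | h'
    · exact (disjoint_left.1 hsep.disjoint_in_out hyi (hno y ⟨hy, h'⟩)).elim
    · exact ((hS0 y hy h').1 hyi).elim
    · exact (disjoint_left.1 hsep.disjoint_in_out hyi (hpo y ⟨hy, h'⟩)).elim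

end Stationary

/-! ### Extrinsic curvature as a Hessian, and light rays emitted tangentially to the surface. -/

section Trapping

set_option maxSynthPendingDepth 3

variable {M : Type*} [TopologicalSpace M] [ChartedSpace E4 M] {φ : ℝ → M → M}
  {e : OpenPartialHomeomorph M E4}
  {S In Out : Set M} {f : E4 → ℝ} {O : Set E4}

theorem toCoord_ofCoord_self (he : e ∈ IsManifold.maximalAtlas (𝓡 4) ∞ M) {x : M}
    (hx : x ∈ e.source) (w : E4) : toCoord e x (ofCoord e (e x) w : E4) = w := by
  have key : ∀ (x' : M) (v : E4), x' = x → (toCoord e x v : E4) = toCoord e x' v := by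
    rintro _ v rfl; rfl
  exact (key _ _ (e.left_inv hx)).trans (toCoord_ofCoord he (e.map_source hx) w)

theorem toCoord_ne_zero (he : e ∈ IsManifold.maximalAtlas (𝓡 4) ∞ M) {x : M}
    (hx : x ∈ e.source) {v : TangentSpace (𝓡 4) x} (hv : v ≠ 0) : toCoord e x v ≠ 0 := by
  intro h
  apply hv
  have h1 := ofCoord_toCoord he hx v
  rw [h] at h1
  exact h1.symm.trans (map_zero (ofCoord e (e x)))

namespace IsDefiningFunction

theorem contDiffAt (hd : IsDefiningFunction φ e S In Out f O) {y : E4} (hy : y ∈ O) :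
    ContDiffAt ℝ ∞ f y :=
  hd.contDiffOn.contDiffAt (hd.isOpen.mem_nhds hy)

theorem hasFDerivAt (hd : IsDefiningFunction φ e S In Out f O) {y : E4} (hy : y ∈ O) :
    HasFDerivAt f (fderiv ℝ f y) y :=
  ((hd.contDiffAt hy).differentiableAt (by simp)).hasFDerivAt

theorem eq_zero_iff_mem (hd : IsDefiningFunction φ e S In Out f O) {x : M} (hx : x ∈ e.source)
    (hxO : e x ∈ O) : f (e x) = 0 ↔ x ∈ S := by
  rw [hd.eq_zero_iff _ hxO, e.left_inv hx]

/-- The part of the manifold on which a local defining function is defined. -/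
theorem isOpen_domain (hd : IsDefiningFunction φ e S In Out f O) :
    IsOpen (e.source ∩ e ⁻¹' O) :=
  e.isOpen_inter_preimage hd.isOpen

theorem fderiv_of_isTangentTo (hd : IsDefiningFunction φ e S In Out f O)
    (he : e ∈ IsManifold.maximalAtlas (𝓡 4) ∞ M) {p : M} (hp : p ∈ e.source) (hpO : e p ∈ O)
    {v : TangentSpace (𝓡 4) p} (hv : IsTangentTo S p v) :
    fderiv ℝ f (e p) (toCoord e p v) = 0 := by
  obtain ⟨c, hc, hcS⟩ := hv
  have h1 := hc.hasDerivAt he hp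
  have h2 : HasFDerivAt f (fderiv ℝ f (e p)) (e (c 0)) := by
    rw [hc.1]; exact hd.hasFDerivAt hpO
  have h3 := h2.comp_hasDerivAt 0 h1
  refine h3.unique ((hasDerivAt_const (0 : ℝ) (0 : ℝ)).congr_of_eventuallyEq ?_)
  filter_upwards [hcS, hc.continuousAt.eventually (hd.isOpen_domain.mem_nhds ⟨hp, hpO⟩)]
    with t ht ht'
  exact (hd.eq_zero_iff_mem ht'.1 ht'.2).2 ht

theorem isTangentTo_ofCoord (hd : IsDefiningFunction φ e S In Out f O)
    (he : e ∈ IsManifold.maximalAtlas (𝓡 4) ∞ M) {y w : E4} (hy : y ∈ O) (hfy : f y = 0)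
    (hw : fderiv ℝ f y w = 0) : IsTangentTo S (e.symm y) (ofCoord e y w) := by
  obtain ⟨x, hx0, hx, hfx⟩ := ((hd.contDiffAt hy).hasStrictFDerivAt
    (by simp)).exists_curve_in_zero_set (hd.fderiv_ne y hy) hfy hw
  refine ⟨fun t ↦ e.symm (x t), hasInitialVelocity_symm he (hd.subset hy) hx0 hx, ?_⟩
  have hxO : ∀ᶠ t in 𝓝 (0 : ℝ), x t ∈ O := by
    apply hx.continuousAt.preimage_mem_nhds
    rw [hx0]
    exact hd.isOpen.mem_nhds hy
  filter_upwards [hxO, hfx] with t ht ht'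
  exact (hd.eq_zero_iff _ ht).1 ht'

variable [IsManifold (𝓡 4) ∞ M] {g : LorentzianMetric M}

theorem isLorentzField (hd : IsDefiningFunction φ e S In Out f O) (g : LorentzianMetric M)
    (he : e ∈ IsManifold.maximalAtlas (𝓡 4) ∞ M) : IsLorentzField (metricForm g e) O where
  isOpen := hd.isOpen
  contDiffOn := (isLorentzField_metricForm g he).contDiffOn.mono hd.subset
  isLorentzForm y hy := (isLorentzField_metricForm g he).isLorentzForm y (hd.subset hy)

/-- Flow invariance makes the gradient orthogonal to the timelike generator, hence spacelike. This
is what allows it to be normalized to a unit normal. -/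
theorem metricGrad_pos (hd : IsDefiningFunction φ e S In Out f O) (hφ : IsStationaryFlow g φ)
    (he : e ∈ IsManifold.maximalAtlas (𝓡 4) ∞ M) {y : E4} (hy : y ∈ O) :
    0 < metricForm g e y (metricGrad (metricForm g e) f y) (metricGrad (metricForm g e) f y) := by
  have hG := hd.isLorentzField g he
  refine (hG.isLorentzForm y hy).pos_of_orthogonal
    (metricForm_chartGenerator_neg hφ he (hd.subset hy)) ?_ fun h ↦ hd.fderiv_ne y hy ?_
  · rw [(hG.isLorentzForm y hy).1, hG.apply_metricGrad hy]
    exact hd.fderiv_generator y hy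
  · ext v
    rw [← hG.apply_metricGrad hy, h, map_zero]

/-- The outward condition makes `f` positive on a curve leaving along `r`, which bounds the
derivative only weakly from below; strictness comes from the unit and normality conditions in
`lieDerivTensor_unitNormal`. -/
theorem outwardUnitNormalAt (hd : IsDefiningFunction φ e S In Out f O)
    (he : e ∈ IsManifold.maximalAtlas (𝓡 4) ∞ M) {y : E4} (hy : y ∈ O) (hfy : f y = 0)
    {r : TangentSpace (𝓡 4) (e.symm y)} (hr : IsOutwardUnitNormalAt g S Out (e.symm y) r) :
    metricForm g e y (toCoord e (e.symm y) r) (toCoord e (e.symm y) r) = 1 ∧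
      (∀ w, fderiv ℝ f y w = 0 → metricForm g e y (toCoord e (e.symm y) r) w = 0) ∧
      0 ≤ fderiv ℝ f y (toCoord e (e.symm y) r) := by
  have hys := e.map_target (hd.subset hy)
  have hey := e.right_inv (hd.subset hy)
  obtain ⟨h1, h2, c, hc, hcO⟩ := hr
  refine ⟨?_, fun w hw ↦ ?_, ?_⟩
  · have := metricForm_toCoord g he hys r r
    rw [hey] at this
    exact this.trans h1
  · have h3 := h2 _ (hd.isTangentTo_ofCoord he hy hfy hw)
    have h4 := metricForm_toCoord g he hys r (ofCoord e y w)
    rw [hey, toCoord_ofCoord he (hd.subset hy)] at h4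
    exact h4.trans h3
  · have h3 := hc.hasDerivAt he hys
    have h4 : HasFDerivAt f (fderiv ℝ f y) (e (c 0)) := by
      rw [hc.1, hey]; exact hd.hasFDerivAt hy
    have h5 := h4.comp_hasDerivAt 0 h3
    by_contra! hneg
    have h6 : ∀ᶠ s in 𝓝[≠] (0 : ℝ), slope (f ∘ fun t ↦ e (c t)) 0 s < 0 :=
      h5.tendsto_slope.eventually (gt_mem_nhds hneg)
    have h7 : ∀ᶠ t in 𝓝 (0 : ℝ), c t ∈ e.source ∩ e ⁻¹' O :=
      hc.continuousAt.eventually (hd.isOpen_domain.mem_nhds ⟨hys, by rwa [mem_preimage, hey]⟩)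
    obtain ⟨t, ⟨⟨ht1, ht2⟩, ht3⟩, ht0⟩ :=
      ((((h6.filter_mono (nhdsWithin_mono (0 : ℝ) fun s (hs : s ∈ Ioi 0) ↦ ne_of_gt hs)).and
      (h7.filter_mono nhdsWithin_le_nhds)).and hcO).and self_mem_nhdsWithin).exists
    have ht0' : (0 : ℝ) < t := ht0
    have h8 : 0 < f (e (c t)) := by
      rw [hd.pos_iff _ ht2.2, e.left_inv ht2.1]
      exact ht3
    rw [slope_def_field, sub_zero, Function.comp_apply, Function.comp_apply, hc.1, hey, hfy,
      sub_zero] at ht1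
    linarith [div_pos h8 ht0']

end IsDefiningFunction

variable [IsManifold (𝓡 4) ∞ M] {g : LorentzianMetric M}

theorem differentiableAt_chartField (he : e ∈ IsManifold.maximalAtlas (𝓡 4) ∞ M)
    {r : (x : M) → TangentSpace (𝓡 4) x} {U : Set M} (hU : IsOpen U)
    (hr : ContMDiffOn (𝓡 4) ((𝓡 4).prod (𝓡 4)) ∞
      (fun x : M ↦ Bundle.TotalSpace.mk' E4 (E := fun y : M ↦ TangentSpace (𝓡 4) y) x (r x)) U)
    {y : E4} (hy : y ∈ e.target) (hyU : e.symm y ∈ U) :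
    DifferentiableAt ℝ (chartField e r) y := by
  have hN : IsOpen (e.target ∩ e.symm ⁻¹' U) := e.isOpen_inter_preimage_symm hU
  have h1 := (contMDiffOn_of_mem_maximalAtlas he).contMDiffOn_tangentMapWithin
    (m := ∞) (by simp) e.open_source.uniqueMDiffOn
  have h2 := hr.comp ((contMDiffOn_symm_of_mem_maximalAtlas he).mono inter_subset_left)
    (fun z (hz : z ∈ e.target ∩ e.symm ⁻¹' U) ↦ hz.2)
  have h3 := h1.comp h2 fun z hz ↦ e.map_target hz.1
  have h4 : ContMDiffOn (𝓡 4) ((𝓡 4).prod (𝓡 4)) ∞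
      (fun z : E4 ↦ (⟨z, chartField e r z⟩ : TangentBundle (𝓡 4) E4))
      (e.target ∩ e.symm ⁻¹' U) := by
    refine h3.congr fun z hz ↦ ?_
    have key : ∀ (z' : E4) (w w' : E4), z' = z → w' = w →
        (⟨z, w⟩ : TangentBundle (𝓡 4) E4) = ⟨z', w'⟩ := by
      rintro _ _ _ rfl rfl; rfl
    refine key _ _ _ (e.right_inv hz.1) ?_
    change mfderivWithin (𝓡 4) (𝓡 4) e e.source (e.symm z) (r (e.symm z)) = _
    rw [mfderivWithin_of_isOpen e.open_source (e.map_target hz.1)]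
    rfl
  have h5 : ContDiffWithinAt ℝ ∞ (chartField e r) (e.target ∩ e.symm ⁻¹' U) y :=
    contMDiffWithinAt_vectorSpace_iff_contDiffWithinAt.1 (h4 y ⟨hy, hyU⟩)
  exact (h5.contDiffAt (hN.mem_nhds ⟨hy, hyU⟩)).differentiableAt (by simp)

namespace IsDefiningFunction

/-- The extrinsic curvature is a positive multiple of the covariant Hessian of a local defining
function. -/
theorem extrinsicCurvature_eq (hd : IsDefiningFunction φ e S In Out f O)
    (he : e ∈ IsManifold.maximalAtlas (𝓡 4) ∞ M) {p : M} (hp : p ∈ e.source) (hpO : e p ∈ O)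
    (hpS : p ∈ S) {r : (x : M) → TangentSpace (𝓡 4) x}
    (hr : IsOutwardUnitNormalNear g S Out p r) {k : TangentSpace (𝓡 4) p}
    (hk : fderiv ℝ f (e p) (toCoord e p k) = 0) :
    ∃ N : ℝ, 0 < N ∧
      extrinsicCurvature g e r p k k = covHess (metricForm g e) f (e p) (toCoord e p k) / N := by
  obtain ⟨U, hU, hpU, hrU, hnormal⟩ := hr
  have hN : ∀ᶠ z in 𝓝 (e p), z ∈ O ∧ e.symm z ∈ U := by
    refine inter_mem (hd.isOpen.mem_nhds hpO) ?_
    apply (e.continuousAt_symm (e.map_source hp)).preimage_mem_nhds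
    rw [e.left_inv hp]
    exact hU.mem_nhds hpU
  have hloc : ∀ᶠ z in 𝓝 (e p), f z = 0 →
      metricForm g e z (chartField e r z) (chartField e r z) = 1 ∧
      (∀ w, fderiv ℝ f z w = 0 → metricForm g e z (chartField e r z) w = 0) ∧
      0 ≤ fderiv ℝ f z (chartField e r z) := by
    filter_upwards [hN] with z hz hfz
    exact hd.outwardUnitNormalAt he hz.1 hfz
      (hnormal (e.symm z) ⟨(hd.eq_zero_iff z hz.1).1 hfz, hz.2⟩)
  have hfp : f (e p) = 0 := (hd.eq_zero_iff_mem hp hpO).2 hpS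
  have hR : DifferentiableAt ℝ (chartField e r) (e p) :=
    differentiableAt_chartField he hU hrU (e.map_source hp) hN.self_of_nhds.2
  obtain ⟨hne, heq⟩ := lieDerivTensor_unitNormal (hd.isLorentzField g he) hd.contDiffOn hpO hfp
    (hd.fderiv_ne _ hpO) hk hR (hloc.mono fun z hz h ↦ (hz h).1)
    (hloc.mono fun z hz h ↦ (hz h).2.1)
  exact ⟨_, lt_of_le_of_ne (hloc.self_of_nhds hfp).2.2 hne.symm, heq⟩

/-- Existence of a smooth outward unit normal near the points of the domain of a local defining
function. -/
theorem exists_outwardUnitNormalNear (hd : IsDefiningFunction φ e S In Out f O)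
    (hφ : IsStationaryFlow g φ) (he : e ∈ IsManifold.maximalAtlas (𝓡 4) ∞ M) :
    ∃ r : (x : M) → TangentSpace (𝓡 4) x, ∀ q ∈ e.source, e q ∈ O →
      IsOutwardUnitNormalNear g S Out q r := by
  have hG := hd.isLorentzField g he
  set n : E4 → E4 := metricGrad (metricForm g e) f with hn
  set R : E4 → E4 := fun y ↦ (√(metricForm g e y (n y) (n y)))⁻¹ • n y with hR
  have hRs : ContDiffOn ℝ ∞ R O := fun y hy ↦
    (contDiffAt_unitGrad hG hd.contDiffOn hy (hd.metricGrad_pos hφ he hy)).contDiffWithinAt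
  have hGR : ∀ y ∈ O, ∀ w, metricForm g e y (R y) w =
      (√(metricForm g e y (n y) (n y)))⁻¹ * fderiv ℝ f y w := by
    intro y hy w
    rw [hR, map_smul, smul_apply, hG.apply_metricGrad hy w, smul_eq_mul]
  have hfR : ∀ y ∈ O, fderiv ℝ f y (R y) = √(metricForm g e y (n y) (n y)) := by
    intro y hy
    have hpos := hd.metricGrad_pos hφ he hy
    rw [hR, map_smul, ← hG.apply_metricGrad hy, smul_eq_mul, ← hn, inv_mul_eq_div, Real.div_sqrt]
  refine ⟨fun x ↦ ofCoord e (e x) (R (e x)), fun q hq hqO ↦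
    ⟨e.source ∩ e ⁻¹' O, hd.isOpen_domain, ⟨hq, hqO⟩,
      contMDiffOn_ofCoord_section he hd.subset hRs, ?_⟩⟩
  rintro x ⟨hxS, hx, hxO⟩
  have hxO' : e x ∈ O := hxO
  have hsq : 0 < √(metricForm g e (e x) (n (e x)) (n (e x))) :=
    Real.sqrt_pos.2 (hd.metricGrad_pos hφ he hxO')
  have hcoord := toCoord_ofCoord_self he hx (R (e x))
  refine ⟨?_, fun v hv ↦ ?_, ?_⟩
  · have h1 := metricForm_toCoord g he hx (ofCoord e (e x) (R (e x)) : E4)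
      (ofCoord e (e x) (R (e x)) : E4)
    rw [hcoord, hGR _ hxO', hfR _ hxO', inv_mul_cancel₀ hsq.ne'] at h1
    exact h1.symm
  · have h1 := metricForm_toCoord g he hx (ofCoord e (e x) (R (e x)) : E4) v
    rw [hcoord, hGR _ hxO', hd.fderiv_of_isTangentTo he hx hxO' hv, mul_zero] at h1
    exact h1.symm
  -- The derivative of `f` along `R` is the length of the gradient, hence positive, so the
  -- coordinate line along `R` enters `Out`.
  · have key : ∀ (x' : M) (w : E4), x' = x → PointsInto Out x' w → PointsInto Out x w := by
      rintro _ w rfl h; exact h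
    refine key _ _ (e.left_inv hx) ?_
    have hline : HasDerivAt (fun t : ℝ ↦ e x + t • R (e x)) (R (e x)) 0 := by
      simpa using ((hasDerivAt_id (0 : ℝ)).smul_const (R (e x))).const_add (e x)
    have h0 : e x + (0 : ℝ) • R (e x) = e x := by simp
    refine ⟨fun t ↦ e.symm (e x + t • R (e x)),
      hasInitialVelocity_symm he (e.map_source hx) h0 hline, ?_⟩
    have hO : ∀ᶠ t in 𝓝 (0 : ℝ), e x + t • R (e x) ∈ O := by
      apply hline.continuousAt.preimage_mem_nhds
      rw [h0]
      exact hd.isOpen.mem_nhds hxO'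
    have h1 : HasFDerivAt f (fderiv ℝ f (e x)) (e x + (0 : ℝ) • R (e x)) := by
      rw [h0]; exact hd.hasFDerivAt hxO'
    have h2 := h1.comp_hasDerivAt 0 hline
    rw [hfR _ hxO'] at h2
    have h3 := h2.tendsto_slope.eventually (lt_mem_nhds hsq)
    filter_upwards [h3.filter_mono (nhdsWithin_mono _ fun s hs ↦ ne_of_gt hs),
      hO.filter_mono nhdsWithin_le_nhds, self_mem_nhdsWithin] with t ht htO ht0
    rw [← hd.pos_iff _ htO]
    rw [slope_def_field, Function.comp_apply, Function.comp_apply, h0,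
      (hd.eq_zero_iff_mem hx hxO').2 hxS, sub_zero, sub_zero] at ht
    exact (div_pos_iff_of_pos_right ht0).1 ht

end IsDefiningFunction

theorem _root_.CoordGeodesicAt.congr {G : E4 → E4 →L[ℝ] E4 →L[ℝ] ℝ} {x x' : ℝ → E4} {t : ℝ}
    (h : CoordGeodesicAt G x t) (hx : x' =ᶠ[𝓝 t] x) : CoordGeodesicAt G x' t := by
  obtain ⟨h1, h2, h3⟩ := h
  refine ⟨hx.symm.differentiableAt_iff.1 h1, hx.deriv.symm.differentiableAt_iff.1 h2, ?_⟩
  rw [hx.deriv.deriv_eq, hx.deriv_eq, hx.eq_of_nhds]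
  exact h3

theorem covHess_neg (G : E4 → E4 →L[ℝ] E4 →L[ℝ] ℝ) (f : E4 → ℝ) (y v : E4) :
    covHess G f y (-v) = covHess G f y v := by
  simp [covHess, firstKind_apply]

/-- If the covariant Hessian of a local defining function is nonpositive on the null vectors
tangent to `S`, then light rays emitted tangentially to `S` do not leave `S ∪ In` immediately. -/
theorem IsDefiningFunction.eventually_mem_of_lightRay (hd : IsDefiningFunction φ e S In Out f O)
    (hφ : IsStationaryFlow g φ) (he : e ∈ IsManifold.maximalAtlas (𝓡 4) ∞ M)
    (hQ : ∀ y ∈ O, f y = 0 → ∀ v, v ≠ 0 → fderiv ℝ f y v = 0 → metricForm g e y v v = 0 →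
      covHess (metricForm g e) f y v ≤ 0)
    {γ : ℝ → M} (hγO : e (γ 0) ∈ O)
    (hgeo : ∀ᶠ t in 𝓝 (0 : ℝ), γ t ∈ e.source ∧ GeodesicEqAt g e (fun s ↦ e (γ s)) t)
    (hnull : ∀ᶠ t in 𝓝 (0 : ℝ), IsNull g (γ t) (velocity γ t))
    (hS : γ 0 ∈ S) (htan : IsTangentTo S (γ 0) (velocity γ 0)) :
    ∀ᶠ t in 𝓝[>] (0 : ℝ), γ t ∈ S ∪ In := by
  have hG := hd.isLorentzField g he
  set x : ℝ → E4 := fun s ↦ e (γ s) with hx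
  have hxc : ContinuousAt x 0 := hgeo.self_of_nhds.2.1.continuousAt
  have hx'c : ContinuousAt (deriv x) 0 := hgeo.self_of_nhds.2.2.1.continuousAt
  have hsrc : ∀ᶠ t in 𝓝 (0 : ℝ), γ t ∈ e.source := hgeo.mono fun t ht ↦ ht.1
  have hxO : ∀ᶠ t in 𝓝 (0 : ℝ), x t ∈ O := hxc.preimage_mem_nhds (hd.isOpen.mem_nhds hγO)
  have hvel : ∀ᶠ t in 𝓝 (0 : ℝ), toCoord e (γ t) (velocity γ t) = deriv x t := by
    filter_upwards [hgeo, hsrc.eventually_nhds] with t ht hts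
    exact toCoord_velocity he ht.1 (mdifferentiableAt_of_chart he hts ht.2.1)
  have hcoord : ∀ᶠ t in 𝓝 (0 : ℝ), CoordGeodesicAt (metricForm g e) x t := by
    filter_upwards [hgeo] with t ht
    exact (geodesicEqAt_iff g he (e.map_source ht.1)).1 ht.2
  have hxnull : ∀ᶠ t in 𝓝 (0 : ℝ), metricForm g e (x t) (deriv x t) (deriv x t) = 0 := by
    filter_upwards [hvel, hsrc, hnull] with t h1 h2 h3
    rw [← h1, metricForm_toCoord g he h2]
    exact h3.2
  have h0s := hsrc.self_of_nhds
  have hf0 : f (x 0) = 0 := (hd.eq_zero_iff_mem h0s hγO).2 hS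
  have hdf0 : fderiv ℝ f (x 0) (deriv x 0) = 0 := by
    rw [← hvel.self_of_nhds]
    exact hd.fderiv_of_isTangentTo he h0s hγO htan
  have hv0 : deriv x 0 ≠ 0 := by
    rw [← hvel.self_of_nhds]
    exact toCoord_ne_zero he h0s hnull.self_of_nhds.1
  -- The generator of the flow serves as the timelike vector tangent to the zero set.
  obtain ⟨C, hC⟩ := exists_covHess_le hG hd.contDiffOn hγO hf0 (hd.fderiv_ne _ hγO) hdf0 hv0
    hxnull.self_of_nhds (metricForm_chartGenerator_neg hφ he (hd.subset hγO))
    (hd.fderiv_generator _ hγO) (by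
      filter_upwards [(hd.isOpen.eventually_mem hγO).prod_inl_nhds (deriv x 0),
        (isOpen_ne.eventually_mem hv0).prod_inr_nhds (x 0)] with z h1 h2 h3 h4 h5
      exact hQ z.1 h1 h3 z.2 h2 h4 h5)
  have hz : Tendsto (fun t ↦ (x t, deriv x t)) (𝓝 0) (𝓝 (x 0, deriv x 0)) :=
    hxc.prodMk_nhds hx'c
  have hle := eventually_nonpos_of_second_deriv_le (h := fun t ↦ f (x t))
    (u := fun t ↦ fderiv ℝ f (x t) (deriv x t))
    (w := fun t ↦ covHess (metricForm g e) f (x t) (deriv x t)) (C := C)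
    (by filter_upwards [hcoord, hxO] with t h1 h2 using (h1.hasDerivAt hG hd.contDiffOn h2).1)
    (by filter_upwards [hcoord, hxO] with t h1 h2 using (h1.hasDerivAt hG hd.contDiffOn h2).2)
    hf0 hdf0
    (by filter_upwards [hz.eventually hC, hxnull] with t h1 h2 using h1 h2)
  filter_upwards [hle, hxO.filter_mono nhdsWithin_le_nhds, hsrc.filter_mono nhdsWithin_le_nhds]
    with t h1 h2 h3
  rcases h1.lt_or_eq with h | h
  · right
    rw [hd.neg_iff _ h2] at h
    rwa [hx, e.left_inv h3] at h
  · left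
    exact (hd.eq_zero_iff_mem h3 h2).1 h

/-- If the covariant Hessian of a local defining function is positive on some null vector tangent
to `S`, then some light ray emitted tangentially to `S` immediately enters `Out`. -/
theorem IsDefiningFunction.exists_lightRay (hd : IsDefiningFunction φ e S In Out f O)
    (hφ : IsStationaryFlow g φ) (he : e ∈ IsManifold.maximalAtlas (𝓡 4) ∞ M) {y k : E4}
    (hy : y ∈ O) (hfy : f y = 0) (hk : fderiv ℝ f y k = 0)
    (hkk : metricForm g e y k k = 0) (hfut : metricForm g e y (chartGenerator φ e y) k < 0)
    (hQ : 0 < covHess (metricForm g e) f y k) :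
    ∃ (γ : ℝ → M) (a b : ℝ), a < 0 ∧ 0 < b ∧ IsLightRayOn g φ γ a b ∧ γ 0 ∈ S ∧
      IsTangentTo S (γ 0) (velocity γ 0) ∧ ∀ᶠ t in 𝓝[>] (0 : ℝ), γ t ∈ Out := by
  have hG := hd.isLorentzField g he
  obtain ⟨x, hx0, hx'0, hx⟩ := exists_null_geodesic hG hy hkk
  have hxc : ContinuousAt x 0 := hx.self_of_nhds.2.1.1.continuousAt
  have hx'c : ContinuousAt (deriv x) 0 := hx.self_of_nhds.2.1.2.1.continuousAt
  have hfuture : ∀ᶠ t in 𝓝 (0 : ℝ),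
      metricForm g e (x t) (chartGenerator φ e (x t)) (deriv x t) < 0 := by
    have h1 : ContinuousAt (fun t ↦ metricForm g e (x t)) 0 :=
      ContinuousAt.comp (g := metricForm g e) (by rw [hx0]; exact (hG.contDiffAt hy).continuousAt)
        hxc
    have h2 : ContinuousAt (fun t ↦ chartGenerator φ e (x t)) 0 :=
      ContinuousAt.comp (g := chartGenerator φ e)
        (by rw [hx0]; exact continuousAt_chartGenerator hφ he (hd.subset hy)) hxc
    have h3 := (h1.clm_apply h2).clm_apply hx'c
    exact h3.eventually_lt_const (by simpa only [hx0, hx'0] using hfut)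
  obtain ⟨δ, δ0, hδ⟩ := Metric.eventually_nhds_iff.1 (hx.and hfuture)
  have hδ' : ∀ t ∈ Ioo (-δ) δ, (x t ∈ O ∧ CoordGeodesicAt (metricForm g e) x t ∧
      metricForm g e (x t) (deriv x t) (deriv x t) = 0) ∧
      metricForm g e (x t) (chartGenerator φ e (x t)) (deriv x t) < 0 := by
    intro t ht
    apply hδ
    rw [Real.dist_eq, sub_zero, abs_lt]
    exact ht
  set γ : ℝ → M := fun t ↦ e.symm (x t) with hγ
  have hsrc : ∀ t ∈ Ioo (-δ) δ, γ t ∈ e.source := fun t ht ↦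
    e.map_target (hd.subset (hδ' t ht).1.1)
  have heγ : ∀ t ∈ Ioo (-δ) δ, e (γ t) = x t := fun t ht ↦
    e.right_inv (hd.subset (hδ' t ht).1.1)
  have hnhds : ∀ t ∈ Ioo (-δ) δ, ∀ᶠ s in 𝓝 t, s ∈ Ioo (-δ) δ := fun t ht ↦
    Ioo_mem_nhds ht.1 ht.2
  have heq : ∀ t ∈ Ioo (-δ) δ, (fun s ↦ e (γ s)) =ᶠ[𝓝 t] x := fun t ht ↦
    (hnhds t ht).mono heγ
  have hvel : ∀ t ∈ Ioo (-δ) δ, toCoord e (γ t) (velocity γ t) = deriv x t := by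
    intro t ht
    rw [toCoord_velocity he (hsrc t ht) (mdifferentiableAt_of_chart he
      ((hnhds t ht).mono hsrc) ((heq t ht).symm.differentiableAt_iff.1 (hδ' t ht).1.2.1.1))]
    exact (heq t ht).deriv_eq
  have h0 : (0 : ℝ) ∈ Ioo (-δ) δ := ⟨by linarith, δ0⟩
  refine ⟨γ, -δ, δ, h0.1, h0.2, ⟨?_, ?_⟩, ?_, ?_, ?_⟩
  · intro t ht
    refine ⟨e, ⟨he, hsrc t ht⟩, (hnhds t ht).mono fun s hs ↦ ⟨hsrc s hs, ?_⟩⟩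
    exact (geodesicEqAt_iff g he (e.map_source (hsrc s hs))).2
      ((hδ' s hs).1.2.1.congr (heq s hs))
  · intro t ht
    obtain ⟨⟨h1, h2, h3⟩, h4⟩ := hδ' t ht
    refine ⟨⟨?_, ?_⟩, ?_⟩
    · intro h
      have h5 := hvel t ht
      rw [h, map_zero] at h5
      rw [← h5, map_zero] at h4
      exact lt_irrefl _ h4
    · rw [← metricForm_toCoord g he (hsrc t ht), hvel t ht, heγ t ht]
      exact h3
    · rw [← metricForm_toCoord g he (hsrc t ht), hvel t ht, heγ t ht]
      exact h4
  · exact (hd.eq_zero_iff _ (by rw [hx0]; exact hy)).1 (by rw [hx0]; exact hfy)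
  · have h1 : (velocity γ 0 : E4) = ofCoord e (x 0) (deriv x 0) := by
      have h2 := ofCoord_toCoord he (hsrc 0 h0) (velocity γ 0)
      rw [hvel 0 h0] at h2
      have key : ∀ y' : E4, y' = x 0 →
          (ofCoord e y' (deriv x 0) : E4) = ofCoord e (x 0) (deriv x 0) := by
        rintro _ rfl; rfl
      exact h2.symm.trans (key _ (heγ 0 h0))
    have h3 : IsTangentTo S (e.symm (x 0)) (ofCoord e (x 0) (deriv x 0)) :=
      hd.isTangentTo_ofCoord he (by rw [hx0]; exact hy) (by rw [hx0]; exact hfy)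
        (by rw [hx0, hx'0]; exact hk)
    exact (congrArg (fun w : E4 ↦ IsTangentTo S (e.symm (x 0)) w) h1).mpr h3
  · have hpos := eventually_pos_of_second_deriv_pos (h := fun t ↦ f (x t))
      (u := fun t ↦ fderiv ℝ f (x t) (deriv x t))
      (hx.mono fun t ht ↦ (ht.2.1.hasDerivAt hG hd.contDiffOn ht.1).1)
      (hx.self_of_nhds.2.1.hasDerivAt hG hd.contDiffOn hx.self_of_nhds.1).2
      (by rw [hx0]; exact hfy) (by rw [hx0, hx'0]; exact hk) (by rw [hx0, hx'0]; exact hQ)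
    filter_upwards [hpos, (hx.mono fun t ht ↦ ht.1).filter_mono nhdsWithin_le_nhds] with t h1 h2
    exact (hd.pos_iff _ h2).1 h1

end Trapping

end Spacetime
end

/-! ### The equivalence. -/

theorem proposition1 {M : Type*} [TopologicalSpace M] [T2Space M] [SecondCountableTopology M]
    [ChartedSpace E4 M] [IsManifold (𝓡 4) ∞ M]
    (g : LorentzianMetric M)
    (φ : ℝ → M → M) (hφ : Spacetime.IsStationaryFlow g φ)
    (τ : M → ℝ) (hτ : Spacetime.IsAdaptedTime φ τ)
    (c : ℝ) (hSlice : Spacetime.IsSpacelikeSlice g τ c)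
    (S₀ In Out : Set M) (hS₀_compact : IsCompact S₀)
    (hS₀ : Spacetime.IsEmbeddedSurfaceInSlice τ c S₀)
    (hdiv : Spacetime.Divides (Spacetime.slice τ c) S₀ In Out) :
    Spacetime.IsTTS g φ (Spacetime.transport φ S₀) (Spacetime.transport φ In) ↔
      ∀ p ∈ Spacetime.transport φ S₀,
        ∀ r : (x : M) → TangentSpace (𝓡 4) x,
          Spacetime.IsOutwardUnitNormalNear g (Spacetime.transport φ S₀)
            (Spacetime.transport φ Out) p r →
        ∀ e : OpenPartialHomeomorph M E4, Spacetime.IsChartAt e p →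
        ∀ k : TangentSpace (𝓡 4) p, Spacetime.IsTangentTo (Spacetime.transport φ S₀) p k →
          Spacetime.IsNull g p k →
          Spacetime.extrinsicCurvature g e r p k k ≤ 0 := by
  have hsep := hdiv.separates hφ hτ
  constructor
  · intro htts p hpS r hr e he k hk hknull
    obtain ⟨f, O, hpO, hd⟩ := Spacetime.exists_isDefiningFunction hφ hτ hS₀ hsep he.1 he.2 hpS
    have hdk := hd.fderiv_of_isTangentTo he.1 he.2 hpO hk
    obtain ⟨N, N0, hN⟩ := hd.extrinsicCurvature_eq he.1 he.2 hpO hpS hr hdk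
    rw [hN]
    by_contra! hpos
    have hQ := (div_pos_iff_of_pos_right N0).1 hpos
    have hkk : Spacetime.metricForm g e (e p) (Spacetime.toCoord e p k)
        (Spacetime.toCoord e p k) = 0 := by
      rw [Spacetime.metricForm_toCoord g he.1 he.2]
      exact hknull.2
    have hfp := (hd.eq_zero_iff_mem he.2 hpO).2 hpS
    have hne := ((hd.isLorentzField g he.1).isLorentzForm _ hpO).ne_zero_of_null
      (Spacetime.metricForm_chartGenerator_neg hφ he.1 (hd.subset hpO))
      (Spacetime.toCoord_ne_zero he.1 he.2 hknull.1) hkk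
    obtain ⟨γ, a, b, ha, hb, hray, hγS, hγt, hout⟩ : ∃ (γ : ℝ → M) (a b : ℝ), a < 0 ∧ 0 < b ∧
        Spacetime.IsLightRayOn g φ γ a b ∧ γ 0 ∈ Spacetime.transport φ S₀ ∧
        Spacetime.IsTangentTo (Spacetime.transport φ S₀) (γ 0) (Spacetime.velocity γ 0) ∧
        ∀ᶠ t in 𝓝[>] (0 : ℝ), γ t ∈ Spacetime.transport φ Out := by
      -- A null vector is either future or past directed. In the second case its negative is future
      -- directed, and the Hessian takes the same value on it.
      rcases hne.lt_or_gt with h | h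
      · exact hd.exists_lightRay hφ he.1 hpO hfp hdk hkk h hQ
      · exact hd.exists_lightRay (k := -Spacetime.toCoord e p k) hφ he.1 hpO hfp
          (by rw [map_neg, hdk, neg_zero]) (by simpa using hkk) (by simpa using h)
          (by rwa [Spacetime.covHess_neg])
    obtain ⟨t, ht, ht'⟩ := ((htts γ a b ha hb hray hγS hγt).and hout).exists
    rcases ht with h | h
    · exact disjoint_left.1 hsep.disjoint_out ht' h
    · exact disjoint_left.1 hsep.disjoint_in_out h ht'
  · intro hK γ a b ha hb hray hγS hγt
    -- The curvature condition holds in every chart, so it applies in the very chart where the ray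
    -- solves the geodesic equation, and no change of chart is needed.
    obtain ⟨e, he, hgeo⟩ := hray.1 0 ⟨ha, hb⟩
    obtain ⟨f, O, hpO, hd⟩ := Spacetime.exists_isDefiningFunction hφ hτ hS₀ hsep he.1 he.2 hγS
    -- The curvature condition is quantified over unit normals, so one must be exhibited before it
    -- yields anything.
    obtain ⟨r, hr⟩ := hd.exists_outwardUnitNormalNear hφ he.1
    refine hd.eventually_mem_of_lightRay hφ he.1 ?_ hpO hgeo ?_ hγS hγt
    · intro y hy hfy v hv0 hv hvv
      have hyt := hd.subset hy
      have hys := e.map_target hyt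
      have hey := e.right_inv hyt
      have hco := Spacetime.toCoord_ofCoord he.1 hyt v
      have hyS := (hd.eq_zero_iff y hy).1 hfy
      have hyO : e (e.symm y) ∈ O := by rwa [hey]
      have hdk : fderiv ℝ f (e (e.symm y)) (Spacetime.toCoord e (e.symm y)
          (Spacetime.ofCoord e y v)) = 0 := by rw [hco, hey, hv]
      obtain ⟨N, N0, hN⟩ := hd.extrinsicCurvature_eq he.1 hys hyO hyS (hr _ hys hyO) hdk
      have hle := hK _ hyS r (hr _ hys hyO) e ⟨he.1, hys⟩ (Spacetime.ofCoord e y v)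
        (hd.isTangentTo_ofCoord he.1 hy hfy hv) ⟨fun h ↦ hv0 (by rw [← hco, h, map_zero]), hvv⟩
      rw [hN, hco, hey] at hle
      by_contra! hpos
      exact hle.not_gt (div_pos hpos N0)
    · filter_upwards [Ioo_mem_nhds ha hb] with t ht
      exact (hray.2 t ht).1
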